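/- **Setting.** Let $\mathcal H$ be a complex Hilbert space and $N$ a positive integer. Let $\{U_{ij}\}_{1\le i<j\le N}$ be commuting unitaries on $\mathcal H$ and put $U_{ji}:=U_{ij}^*$ for $i<j$. Let $V=(V_1,\dots,V_N)$ be a $\mathcal U_N$-twisted tuple of power partial isometries with respect to $\{U_{ij}\}$; that is, every power $V_i^n$ ($n\ge 0$) is a partial isometry, and for all $i\ne j$ and all $k$ $$V_i^*V_j=U_{ij}V_jV_i^*,\qquad V_iV_j=U_{ji}V_jV_i,\qquad V_kU_{ij}=U_{ij}V_k .$$ **Notation.** Let $I=\{u,s,b\}\cup\{p\in\mathbb N:p\ge 1\}$. For $i\in I^N$ let $\Phi_i=\{n: i_n\ne u\}$. For $n\in\Phi_i$ let $\mathcal K_{i,n}=\ell^2(\mathbb N)$ with orthonormal basis $e_0,e_1,\dots$ if $i_n\in\{s,b\}$, and $\mathcal K_{i,n}=\mathbb C^p$ with basis $e_1,\dots,e_p$ if $i_n=p$. Let $S_{i,n}$ be the unilateral shift $S$ if $i_n=s$, its adjoint $S^*$ if $i_n=b$, and the truncated shift $J_p$ ($J_pe_k=e_{k+1}$ for $k<p$,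 $J_pe_p=0$) if $i_n=p$. For a Hilbert space $\mathcal M$ and a unitary $W$ on $\mathcal M$, the diagonal operator in the slot $m\in\Phi_i$ with symbol $W$ is the unitary on $(\bigotimes_{n\in\Phi_i}\mathcal K_{i,n})\otimes\mathcal M$ given by $$D_m[W](e_k\otimes\eta)=e_k\otimes W^{k_m}\eta \ \text{ if } i_m\in\{s,b\},\qquad D_m[W](e_k\otimes\eta)=e_k\otimes W^{k_m-1}\eta\ \text{ if } i_m=p,$$ where $e_k=\bigotimes_{n\in\Phi_i} e_{k_n}$ (in the case $i_m=p$ this is the operator usually written $d_m[W]$). **Theorem.** There are closed subspaces $\{\mathcal H_i\}_{i\in I^N}$ of $\mathcal H$ (some of them possibly zero), each reducing for every $V_n$, with $\mathcal H=\bigoplus_{i\in I^N}\mathcal H_i$ (orthogonal Hilbert space direct sum). Moreover, for each $i\in I^N$ there are a Hilbert space $\mathcal M_i$, commuting unitaries $U^{(i)}_{mn}$ ($m\ne n$) on $\mathcal M_i$ with $U^{(i)}_{nm}=(U^{(i)}_{mn})^*$, unitaries $T_{i,n}$ on $\mathcal M_i$ for those $n$ with $i_n=u$, and a single unitary $$\mathcal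 H_i\;\cong\;\Big(\bigotimes_{n\in\Phi_i}\mathcal K_{i,n}\Big)\otimes\mathcal M_i$$ with the following properties. 1. It carries each $U_{mn}|_{\mathcal H_i}$ ($m\neq n$) to $1\otimes U^{(i)}_{mn}$. 2. Write $D^{(n)}_m:=D_m[U^{(i)}_{mn}]$ if $i_m=s$ or $i_m=p$, and $D^{(n)}_m:=D_m[U^{(i)}_{nm}]$ if $i_m=b$. For every $n$ with $i_n\ne u$ it carries $V_n|_{\mathcal H_i}$ to $$\Big(\prod_{m\in\Phi_i,\ m<n}D^{(n)}_m\Big)\,\big(S_{i,n}\text{ in the slot } n,\ \text{identity in all other slots and on }\mathcal M_i\big).$$ 3. For every $n$ with $i_n=u$ it carries $V_n|_{\mathcal H_i}$ to $$\Big(\prod_{m\in\Phi_i}D^{(n)}_m\Big)\,(1\otimes T_{i,n}).$$ 4. For $m\ne n$ with $i_m=i_n=u$ one has $T_{i,m}^*T_{i,n}=U^{(i)}_{mn}T_{i,n}T_{i,m}^*$ and $T_{i,m}T_{i,n}=U^{(i)}_{nm}T_{i,n}T_{i,m}$, and every $T_{i,k}$ with $i_k=u$ commutes with all $U^{(i)}_{mn}$,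 $m\neq n$. -/

import Mathlib

universe v

noncomputable section

namespace TwistedPPI

/-! ### Twisted tuples of power partial isometries -/

section Operators

open ContinuousLinearMap

variable {H : Type*} [NormedAddCommGroup H] [InnerProductSpace ℂ H] [CompleteSpace H]

/-- A bounded operator that is isometric on the orthogonal complement of its kernel. -/
def IsPartialIsometry (V : H →L[ℂ] H) : Prop :=
  ∀ x ∈ (LinearMap.ker V.toLinearMap)ᗮ, ‖V x‖ = ‖x‖

/-- All powers of `V` are partial isometries. -/
def IsPowerPartialIsometry (V : H →L[ℂ] H) : Prop :=
  ∀ n : ℕ, IsPartialIsometry (V ^ n)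

/-- `V = (V_1, …, V_N)` is a twisted tuple of power partial isometries with respect to the
commuting unitaries `U i j`, `i < j`, where `U j i = (U i j)*`.  The diagonal entries `U i i` play
no role. -/
structure IsTwistedTuple {N : ℕ} (U : Fin N → Fin N → (H →L[ℂ] H)) (V : Fin N → (H →L[ℂ] H)) :
    Prop where
  unitary_mem : ∀ i j, i < j → U i j ∈ unitary (H →L[ℂ] H)
  adjoint_eq : ∀ i j, i < j → U j i = adjoint (U i j)
  commute : ∀ i j k l, i < j → k < l → U i j * U k l = U k l * U i j
  powerPartialIsometry : ∀ i, IsPowerPartialIsometry (V i)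
  twist_adjoint : ∀ i j, i ≠ j → adjoint (V i) * V j = U i j * V j * adjoint (V i)
  twist : ∀ i j, i ≠ j → V i * V j = U j i * V j * V i
  central : ∀ i j k, i ≠ j → V k * U i j = U i j * V k

/-- The subspace `K` is invariant under `V` and under its adjoint. -/
def IsReducing (V : H →L[ℂ] H) (K : Submodule ℂ H) : Prop :=
  ∀ x ∈ K, V x ∈ K ∧ adjoint V x ∈ K

end Operators

/-! ### Slots -/

/-- The index set `{u, s, b} ∪ {1, 2, 3, …}`: unitary, shift, backward shift, truncated shift. -/
inductive SlotType : Type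
  | u : SlotType
  | s : SlotType
  | b : SlotType
  | trunc : ℕ+ → SlotType

namespace SlotType

/-- An orthonormal basis of the slot space: `ℓ²(ℕ)` for `s` and `b`, `ℂ^p` for `p` (its basis
vector `e_{k+1}` has the label `k`).  The one-point set for `u` stands for the trivial tensor
factor `ℂ`, that is, for no factor at all. -/
def Idx : SlotType → Type
  | u => Unit
  | s => ℕ
  | b => ℕ
  | trunc p => Fin p

/-- The exponent (`k` on `e_k` in `ℓ²(ℕ)`, and `k - 1` on `e_k` in `ℂ^p`, basis numbered from one)
in the diagonal operators. -/
def exponent : (c : SlotType) → c.Idx → ℕ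
  | u, _ => 0
  | s, k => k
  | b, k => k
  | trunc _, k => k.val

/-- The label of the basis vector that the slot operator sends to `e_k`, if there is one: the
unilateral shift `S` for `s`, its adjoint `S*` for `b`, the truncated shift `J_p` for `p`. -/
def source : (c : SlotType) → c.Idx → Option c.Idx
  | u, k => some k
  | s, k => Nat.ppred k
  | b, k => some (Nat.succ k)
  | trunc _, k =>
    if 0 < k.val then some ⟨k.val - 1, lt_of_le_of_lt (Nat.sub_le _ _) k.isLt⟩ else none

theorem source_injective (c : SlotType) {k k' l : c.Idx} (h : c.source k = some l)
    (h' : c.source k' = some l) : k = k' := by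
  cases c with
  | u => rfl
  | s =>
    have h1 : Nat.succ l = k := Nat.ppred_eq_some.1 h
    have h2 : Nat.succ l = k' := Nat.ppred_eq_some.1 h'
    exact h1.symm.trans h2
  | b =>
    exact Nat.succ.inj (Option.some.inj (h.trans h'.symm))
  | trunc p =>
    simp only [source] at h h'
    split_ifs at h h' with h1 h2
    have h3 := congrArg Fin.val (Option.some.inj (h.trans h'.symm))
    apply Fin.ext
    simp only at h3
    omega

end SlotType

/-! ### Operators on vector valued `ℓ²` spaces -/

section WeightedOp

variable {ι M : Type*} [NormedAddCommGroup M] [InnerProductSpace ℂ M] [CompleteSpace M]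

/-- The finite partial sums of the squared norm of `k ↦ A k (f (σ k))` are bounded by `‖f‖ ^ 2`. -/
theorem sum_weighted_le (σ : ι → Option ι)
    (hσ : ∀ k k' l, σ k = some l → σ k' = some l → k = k') (A : ι → unitary (M →L[ℂ] M))
    (f : lp (fun _ : ι => M) 2) (t : Finset ι) :
    ∑ k ∈ t, ‖(σ k).elim 0 (fun l => (A k : M →L[ℂ] M) (f l))‖ ^ (2 : ENNReal).toReal
      ≤ ‖f‖ ^ (2 : ENNReal).toReal := by
  classical
  have hA : ∀ k (y : M), ‖(A k : M →L[ℂ] M) y‖ = ‖y‖ := fun k y =>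
    (Unitary.linearIsometryEquiv (A k)).norm_map y
  have h2 : (0 : ℝ) < (2 : ENNReal).toReal := by norm_num
  set τ : ι → ι := fun k => (σ k).getD k with hτ
  have hinj : Set.InjOn τ (t.filter fun k => (σ k).isSome) := by
    intro a ha b hb hab
    simp only [Finset.coe_filter, Set.mem_ofPred_eq, Option.isSome_iff_exists] at ha hb
    obtain ⟨-, x, hx⟩ := ha
    obtain ⟨-, y, hy⟩ := hb
    simp only [hτ, hx, hy, Option.getD_some] at hab
    exact hσ a b x hx (hab ▸ hy)
  calc ∑ k ∈ t, ‖(σ k).elim 0 (fun l => (A k : M →L[ℂ] M) (f l))‖ ^ (2 : ENNReal).toReal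
      = ∑ k ∈ t.filter (fun k => (σ k).isSome), ‖f (τ k)‖ ^ (2 : ENNReal).toReal := by
        rw [Finset.sum_filter]
        refine Finset.sum_congr rfl fun k _ => ?_
        rcases h : σ k with _ | l
        · simp
        · simp [hτ, h, hA]
    _ = ∑ l ∈ (t.filter fun k => (σ k).isSome).image τ, ‖f l‖ ^ (2 : ENNReal).toReal :=
        (Finset.sum_image (f := fun l => ‖f l‖ ^ (2 : ENNReal).toReal) hinj).symm
    _ ≤ ‖f‖ ^ (2 : ENNReal).toReal := lp.sum_rpow_le_norm_rpow h2 f _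

/-- The operator `f ↦ (k ↦ A k (f (σ k)))` on `ℓ²(ι; M)`, where the value is `0` if `σ k` is
undefined; `σ` is an injective partial map and all `A k` are unitary. -/
def weightedOp (σ : ι → Option ι)
    (hσ : ∀ k k' l, σ k = some l → σ k' = some l → k = k') (A : ι → unitary (M →L[ℂ] M)) :
    lp (fun _ : ι => M) 2 →L[ℂ] lp (fun _ : ι => M) 2 :=
  LinearMap.mkContinuous
    { toFun := fun f => ⟨fun k => (σ k).elim 0 (fun l => (A k : M →L[ℂ] M) (f l)),
        memℓp_gen' (sum_weighted_le σ hσ A f)⟩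
      map_add' := fun f g => by
        ext k
        change ((σ k).elim 0 _ : M) = (σ k).elim (0 : M) _ + (σ k).elim (0 : M) _
        rcases h : σ k with _ | l <;> simp
      map_smul' := fun a f => by
        ext k
        change ((σ k).elim 0 _ : M) = a • (σ k).elim (0 : M) _
        rcases h : σ k with _ | l <;> simp }
    1 (fun f => by
      rw [one_mul]
      exact lp.norm_le_of_forall_sum_le (by norm_num) (norm_nonneg f)
        (sum_weighted_le σ hσ A f))

theorem weightedOp_apply (σ : ι → Option ι)
    (hσ : ∀ k k' l, σ k = some l → σ k' = some l → k = k') (A : ι → unitary (M →L[ℂ] M))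
    (f : lp (fun _ : ι => M) 2) (k : ι) :
    weightedOp σ hσ A f k = (σ k).elim 0 (fun l => (A k : M →L[ℂ] M) (f l)) := rfl

end WeightedOp

/-! ### The tensor models -/

section Model

variable {N : ℕ} (c : Fin N → SlotType)

/-- Multi-indices: the labels of the orthonormal basis `e_k = ⊗_n e_{k_n}` of the Hilbert space
tensor product of the slot spaces. -/
abbrev MultiIdx : Type := (n : Fin N) → (c n).Idx

variable (M : Type*) [NormedAddCommGroup M] [InnerProductSpace ℂ M]

/-- The Hilbert space tensor product of the slot spaces and of `M`, realized as the space of square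
summable `M`-valued functions of the multi-index; `e_k ⊗ η` is `lp.single 2 k η`. -/
abbrev ModelSpace : Type _ := lp (fun _ : MultiIdx c => M) 2

variable {M} [CompleteSpace M]

/-- `1 ⊗ T`, where `T` acts on the last factor `M`. -/
def lastOp (T : unitary (M →L[ℂ] M)) : ModelSpace c M →L[ℂ] ModelSpace c M :=
  weightedOp some (fun _ _ _ h h' => Option.some.inj (h.trans h'.symm)) (fun _ => T)

/-- The diagonal operator with symbol `W` in the slot `m`: it sends `e_k ⊗ η` to
`e_k ⊗ W ^ (k_m) η` (`e_k ⊗ W ^ (k_m - 1) η` for a finite dimensional slot, whose basis is numbered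
from one). -/
def diagOp (m : Fin N) (W : unitary (M →L[ℂ] M)) : ModelSpace c M →L[ℂ] ModelSpace c M :=
  weightedOp some (fun _ _ _ h h' => Option.some.inj (h.trans h'.symm))
    (fun k => W ^ (c m).exponent (k m))

/-- The operator `S`, `S*` or `J_p` (as the type of the slot says) in the slot `n`, and the identity
in all the other slots and on `M`. -/
def slotOp (n : Fin N) : ModelSpace c M →L[ℂ] ModelSpace c M :=
  weightedOp (fun k => ((c n).source (k n)).map (Function.update k n))
    (fun k k' l h h' => by
      rw [Option.map_eq_some_iff] at h h'
      obtain ⟨x, hx, rfl⟩ := h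
      obtain ⟨y, hy, hxy⟩ := h'
      have hyx : y = x := by simpa using congrFun hxy n
      subst hyx
      funext j
      by_cases hj : j = n
      · subst hj
        exact (c j).source_injective hx hy
      · simpa [hj] using (congrFun hxy j).symm)
    (fun _ => 1)

/-- The symbol of the twist that the `n`-th operator carries in the slot `m`: `U_{mn}` if the slot
is a shift or a truncated shift, and `U_{nm}` if it is a backward shift. -/
def twistSymbol (W : Fin N → Fin N → unitary (M →L[ℂ] M)) (n m : Fin N) : unitary (M →L[ℂ] M) :=
  match c m with
  | SlotType.b => W n m
  | _ => W m n

open Classical in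
/-- The product of the twists that the `n`-th operator carries in the slots that satisfy `P`. -/
def twistProd (W : Fin N → Fin N → unitary (M →L[ℂ] M)) (n : Fin N) (P : Fin N → Prop) :
    ModelSpace c M →L[ℂ] ModelSpace c M :=
  (((List.finRange N).filter (fun m => P m)).map fun m => diagOp c m (twistSymbol c W n m)).prod

open Classical in
/-- The `n`-th model operator.  If the `n`-th type is not `u`, it is `S`, `S*` or `J_p` in the slot
`n`, a twist in every slot `m < n`, and the identity elsewhere.  If the `n`-th type is `u`, it is the
unitary `T n` on the last factor `M` and a twist in every slot (all of which precede `M`). -/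
def modelOp (W : Fin N → Fin N → unitary (M →L[ℂ] M)) (T : Fin N → unitary (M →L[ℂ] M))
    (n : Fin N) : ModelSpace c M →L[ℂ] ModelSpace c M :=
  if c n = SlotType.u then
    twistProd c W n (fun m => c m ≠ SlotType.u) * lastOp c (T n)
  else
    twistProd c W n (fun m => c m ≠ SlotType.u ∧ m < n) * slotOp c n

end Model

end TwistedPPI

end

noncomputable section

namespace TwistedPPI

/-! ### Power partial isometries in a C*-ring -/

section PowProj

variable {A : Type*} [Ring A] [StarRing A]

/-! The range projections `V_j^n V_j*^n` and `V_j*^n V_j^n` all commute. For one `j` this comes from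
the powers being partial isometries (`PowerPartial.powProj_commute_star`); for different `j` the
twists picked up from `V_j` and `V_j*` cancel (`IsTwistedTuple.commute_powProj`). For fixed `j` and
direction the projections decrease from the identity, so `H` is spanned by orthogonal joint level
spaces: one assigns to each `j` the numbers in `ℕ∞` of backward and forward steps that a vector
survives (`eq_zero_of_orthogonal_jointLevel`).

A pair of levels is the same as a slot type with a basis vector: `(∞, ∞)` is `u`, `(n, ∞)` is `e_n`
for the shift, `(∞, m)` is `e_m` for the backward shift, and `(n, m)` is the vector with label `n`
for the truncated shift of size `n + m + 1`. A multi-index of types thus collects the level spaces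
into one summand. Let `M` be the level space of the base labels. Powers of `V_j` (of `V_j*` in
backward slots) shift levels isometrically (`pow_dirOp_mem_jointLevel`), so the monomial in these
powers, in increasing order of slots, carries `M` onto the level space of `k`. Sending `e_k ⊗ η` to
the monomial applied to `η` is the required unitary.

Moving `V_n` through the monomial creates one twist for each basis step in the slots passed. If slot
`n` is not `u`, `V_n` stops at its own power and sees only slots `m < n`; if it is `u`, it passes
all slots and acts on `M`, where it is unitary. -/

/-- The range projection `v ^ n (v ^ n)*`. -/
def powProj (v : A) (n : ℕ) : A := v ^ n * star v ^ n

/-- All powers of `v` are partial isometries, in the algebraic form `w w* w = w`. -/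
def PowerPartial (v : A) : Prop := ∀ n : ℕ, v ^ n * star v ^ n * v ^ n = v ^ n

theorem PowerPartial.adjoint {v : A} (hv : PowerPartial v) : PowerPartial (star v) := fun n => by
  simpa [mul_assoc] using congrArg star (hv n)

theorem powProj_zero (v : A) : powProj v 0 = 1 := by simp [powProj]

theorem star_powProj (v : A) (n : ℕ) : star (powProj v n) = powProj v n := by
  simp [powProj]

theorem powProj_succ (v : A) (n : ℕ) : powProj v (n + 1) = v * powProj v n * star v := by
  simp only [powProj, pow_succ' v, pow_succ (star v), mul_assoc]

theorem powProj_add (v : A) (n e : ℕ) :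
    powProj v (n + e) = v ^ e * powProj v n * star v ^ e := by
  simp only [powProj, pow_add (star v), add_comm n e, pow_add v, mul_assoc]
  rw [← pow_add, add_comm, pow_add]

theorem PowerPartial.powProj_mul_pow {v : A} (hv : PowerPartial v) (n : ℕ) :
    powProj v n * v ^ n = v ^ n := hv n

theorem PowerPartial.pow_mul_powProj_star {v : A} (hv : PowerPartial v) (n : ℕ) :
    v ^ n * powProj (star v) n = v ^ n := by
  rw [powProj, star_star, ← mul_assoc, hv n]

theorem PowerPartial.powProj_mul_of_le {v : A} (hv : PowerPartial v) {m n : ℕ} (h : m ≤ n) :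
    powProj v m * powProj v n = powProj v n := by
  obtain ⟨k, rfl⟩ := Nat.exists_eq_add_of_le' h
  rw [powProj_add, ← mul_assoc, ← mul_assoc, hv.powProj_mul_pow]

theorem PowerPartial.mul_powProj_of_le {v : A} (hv : PowerPartial v) {m n : ℕ} (h : m ≤ n) :
    powProj v n * powProj v m = powProj v n := by
  simpa [star_powProj] using congrArg star (hv.powProj_mul_of_le h)

theorem PowerPartial.powProj_commute {v : A} (hv : PowerPartial v) (m n : ℕ) :
    Commute (powProj v m) (powProj v n) := by
  rcases le_total m n with h | h
  · exact (hv.powProj_mul_of_le h).trans (hv.mul_powProj_of_le h).symm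
  · exact (hv.mul_powProj_of_le h).trans (hv.powProj_mul_of_le h).symm

end PowProj

/-! ### Interaction of forward and backward range projections -/

section CStar

variable {A : Type*} [NormedRing A] [StarRing A] [CStarRing A]

/-- Two projections commute as soon as their product is idempotent. -/
theorem commute_of_mul_idempotent {p q : A} (hp : star p = p) (hp2 : p * p = p) (hq : star q = q)
    (hq2 : q * q = q) (h : p * q * (p * q) = p * q) : Commute p q := by
  -- By the C*-identity it suffices that `z* z = 0` for `z = pq - qpq`. Then `pq = qpq` is
  -- self-adjoint, which gives `pq = qp`.
  have h1 : p * q - q * (p * q) = 0 := by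
    rw [← CStarRing.star_mul_self_eq_zero_iff]
    have : star (p * q - q * (p * q)) * (p * q - q * (p * q))
        = q * (p * p) * q - q * (p * q * (p * q)) - q * (p * q * (p * q))
          + q * p * (q * q) * p * q := by
      simp only [star_sub, star_mul, hp, hq]
      noncomm_ring
    rw [this, h, hp2, hq2]
    have h3 : q * p * q * p * q = q * (p * q * (p * q)) := by noncomm_ring
    rw [h3, h]
    noncomm_ring
  have h2 : p * q = q * (p * q) := sub_eq_zero.1 h1
  have h3 : q * p = q * (p * q) := by
    simpa [star_mul, hp, hq, mul_assoc] using congrArg star h2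
  exact h2.trans h3.symm

/-- The product of the two projections is idempotent because `v ^ (m + n)` is itself a partial
isometry: the relation `w w* w = w` for that power sits in the middle of the squared product. -/
theorem PowerPartial.powProj_commute_star {v : A} (hv : PowerPartial v) (m n : ℕ) :
    Commute (powProj (star v) m) (powProj v n) := by
  refine commute_of_mul_idempotent (star_powProj _ _) (hv.adjoint.powProj_mul_of_le le_rfl)
    (star_powProj _ _) (hv.powProj_mul_of_le le_rfl) ?_
  have h := hv (m + n)
  rw [pow_add v, add_comm m n, pow_add (star v)] at h
  have h2 : powProj (star v) m * powProj v n * (powProj (star v) m * powProj v n)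
      = star v ^ m * (v ^ m * v ^ n * (star v ^ n * star v ^ m) * (v ^ m * v ^ n)) * star v ^ n := by
    simp only [powProj, star_star, mul_assoc]
  rw [h2, h]
  simp only [powProj, star_star, mul_assoc]

/-- Together with the next lemma this is the level bookkeeping: `v ^ e` raises the level for `v` by
`e` and lowers the level for `star v` by `e`. Both follow by commuting a forward and a backward
projection and absorbing one of them into `v ^ e`. -/
theorem PowerPartial.powProj_add_mul_pow {v : A} (hv : PowerPartial v) (n e : ℕ) :
    powProj v (n + e) * v ^ e = v ^ e * powProj v n := by
  have h : powProj v (n + e) * v ^ e = v ^ e * (powProj v n * powProj (star v) e) := by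
    rw [powProj_add, powProj, powProj, star_star]
    simp only [mul_assoc]
  rw [h, ← (hv.powProj_commute_star e n).eq, ← mul_assoc, hv.pow_mul_powProj_star]

theorem PowerPartial.powProj_star_mul_pow {v : A} (hv : PowerPartial v) (n e : ℕ) :
    powProj (star v) n * v ^ e = v ^ e * powProj (star v) (n + e) := by
  have h : v ^ e * powProj (star v) (n + e) = powProj v e * powProj (star v) n * v ^ e := by
    rw [powProj_add, star_star, show powProj v e = v ^ e * star v ^ e from rfl]
    simp only [mul_assoc]
  rw [h, ← (hv.powProj_commute_star n e).eq, mul_assoc, hv.powProj_mul_pow]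

end CStar

/-! ### Twisted tuples have commuting range projections -/

section Operators

variable {H : Type*} [NormedAddCommGroup H] [InnerProductSpace ℂ H] [CompleteSpace H]

/-- By polarization `V` preserves inner products on the complement of its kernel, so `V* V` fixes
that complement; on the kernel both sides vanish. -/
theorem IsPartialIsometry.mul_star_mul {V : H →L[ℂ] H} (hV : IsPartialIsometry V) :
    V * star V * V = V := by
  set K := LinearMap.ker V.toLinearMap with hK
  have hcl : IsClosed (K : Set H) := V.isClosed_ker
  have : CompleteSpace K := hcl.completeSpace_coe
  let L : Kᗮ →ₗᵢ[ℂ] H := ⟨V.toLinearMap ∘ₗ Kᗮ.subtype, fun x => hV x x.2⟩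
  have hinner : ∀ y ∈ Kᗮ, ∀ z ∈ Kᗮ, inner ℂ (V y) (V z) = inner ℂ y z := fun y hy z hz =>
    L.inner_map_map ⟨y, hy⟩ ⟨z, hz⟩
  have hdec : ∀ x : H, ∃ y ∈ K, ∃ z ∈ Kᗮ, x = y + z := fun x => by
    obtain ⟨y, hy, z, hz, h⟩ := Submodule.exists_add_mem_mem_orthogonal (K := K) x
    exact ⟨y, hy, z, hz, h⟩
  have hker : ∀ y ∈ K, V y = 0 := fun y hy => hy
  have hfix : ∀ y ∈ Kᗮ, star V (V y) = y := by
    intro y hy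
    refine ext_inner_right ℂ fun x => ?_
    obtain ⟨k, hk, z, hz, rfl⟩ := hdec x
    rw [ContinuousLinearMap.star_eq_adjoint, ContinuousLinearMap.adjoint_inner_left, map_add,
      hker k hk, zero_add, hinner y hy z hz, inner_add_right,
      Submodule.inner_left_of_mem_orthogonal hk hy, zero_add]
  ext x
  obtain ⟨k, hk, z, hz, rfl⟩ := hdec x
  change V (star V (V (k + z))) = V (k + z)
  rw [map_add, hker k hk, zero_add, hfix z hz]

theorem IsPowerPartialIsometry.powerPartial {V : H →L[ℂ] H} (hV : IsPowerPartialIsometry V) :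
    PowerPartial V := fun n => by
  rw [← star_pow]
  exact (hV n).mul_star_mul

/-- `V j` or its adjoint. -/
def dirOp {N : ℕ} (V : Fin N → (H →L[ℂ] H)) (j : Fin N) (t : Bool) : H →L[ℂ] H :=
  if t then V j else star (V j)

/-- The factor that `V n` picks up when it passes `dirOp V m t` from the left. -/
def dirSymbol {N : ℕ} (U : Fin N → Fin N → (H →L[ℂ] H)) (n m : Fin N) (t : Bool) : H →L[ℂ] H :=
  if t then U m n else U n m

theorem star_dirOp {N : ℕ} (V : Fin N → (H →L[ℂ] H)) (j : Fin N) (t : Bool) :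
    star (dirOp V j t) = dirOp V j (!t) := by
  cases t <;> simp [dirOp]

namespace IsTwistedTuple

variable {N : ℕ} {U : Fin N → Fin N → (H →L[ℂ] H)} {V : Fin N → (H →L[ℂ] H)}

theorem powerPartial (h : IsTwistedTuple U V) (j : Fin N) (t : Bool) :
    PowerPartial (dirOp V j t) := by
  have hj := (h.powerPartialIsometry j).powerPartial
  cases t
  · exact hj.adjoint
  · exact hj

theorem star_eq (h : IsTwistedTuple U V) {i j : Fin N} (hij : i ≠ j) :
    star (U i j) = U j i := by
  rcases lt_or_gt_of_ne hij with hlt | hlt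
  · exact (h.adjoint_eq i j hlt).symm
  · rw [h.adjoint_eq j i hlt, ← ContinuousLinearMap.star_eq_adjoint, star_star]

theorem mem_unitary (h : IsTwistedTuple U V) {i j : Fin N} (hij : i ≠ j) :
    U i j ∈ unitary (H →L[ℂ] H) := by
  rcases lt_or_gt_of_ne hij with hlt | hlt
  · exact h.unitary_mem i j hlt
  · rw [h.adjoint_eq j i hlt]
    exact Unitary.star_mem (h.unitary_mem j i hlt)

theorem mul_swap (h : IsTwistedTuple U V) {i j : Fin N} (hij : i ≠ j) : U i j * U j i = 1 := by
  rw [← h.star_eq hij]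
  exact Unitary.mul_star_self_of_mem (h.mem_unitary hij)

theorem commute_dirOp (h : IsTwistedTuple U V) {i j : Fin N} (hij : i ≠ j) (k : Fin N) (t : Bool) :
    Commute (U i j) (dirOp V k t) := by
  cases t
  · have h1 : V k * U j i = U j i * V k := h.central j i k hij.symm
    have h2 := congrArg star h1
    rw [star_mul, star_mul, h.star_eq hij.symm] at h2
    exact h2
  · exact (h.central i j k hij).symm

theorem commute_symbols (h : IsTwistedTuple U V) {i j k l : Fin N} (hij : i ≠ j) (hkl : k ≠ l) :
    Commute (U i j) (U k l) := by
  have key : ∀ {i j k l : Fin N}, i < j → k ≠ l → Commute (U i j) (U k l) := by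
    intro i j k l hij hkl
    rcases lt_or_gt_of_ne hkl with hlt | hlt
    · exact h.commute i j k l hij hlt
    · have h1 : Commute (U i j) (U l k) := h.commute i j l k hij hlt
      have hu := h.mul_swap hkl
      have hu' := h.mul_swap hkl.symm
      calc U i j * U k l = (U k l * U l k) * (U i j * U k l) := by rw [hu, one_mul]
        _ = U k l * (U l k * U i j) * U k l := by simp only [mul_assoc]
        _ = U k l * (U i j * U l k) * U k l := by rw [h1.eq]
        _ = U k l * U i j * (U l k * U k l) := by simp only [mul_assoc]
        _ = U k l * U i j := by rw [hu', mul_one]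
  rcases lt_or_gt_of_ne hij with hlt | hlt
  · exact key hlt hkl
  · rw [← h.star_eq hlt.ne, ← h.star_eq hkl.symm]
    exact (key hlt hkl.symm).star_star

/-- For the adjoint direction, the relation for `V_m* V_n` is solved for `V_n V_m*` by multiplying
with `U n m`, the inverse of `U m n`. -/
theorem mul_dirOp (h : IsTwistedTuple U V) {n m : Fin N} (hnm : n ≠ m) (t : Bool) :
    V n * dirOp V m t = dirSymbol U n m t * dirOp V m t * V n := by
  cases t
  · change V n * star (V m) = U n m * star (V m) * V n
    have h1 : star (V m) * V n = U m n * V n * star (V m) := h.twist_adjoint m n hnm.symm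
    rw [mul_assoc, h1, ← mul_assoc, ← mul_assoc, h.mul_swap hnm, one_mul]
  · exact h.twist n m hnm

/-- Induction through `P_{n+1} = X P_n X*`: passing `X` and passing `X*` produce mutually inverse
central factors, so no twist remains. -/
theorem commute_powProj (h : IsTwistedTuple U V) {i j : Fin N} (hij : i ≠ j) (s t : Bool) (n : ℕ) :
    Commute (dirOp V i s) (powProj (dirOp V j t) n) := by
  have hU : ∀ {a b : Fin N}, a ≠ b → ∀ n, Commute (U a b) (powProj (dirOp V j t) n) :=
    fun hab n => by
      have h1 := h.commute_dirOp hab j t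
      have h2 := h.commute_dirOp hab j (!t)
      rw [← star_dirOp] at h2
      exact (h1.pow_right n).mul_right (h2.pow_right n)
  have key : ∀ n, Commute (V i) (powProj (dirOp V j t) n) := by
    intro n
    induction n with
    | zero => rw [powProj_zero]; exact Commute.one_right _
    | succ n ih =>
      have hsym : ∀ t', Commute (dirSymbol U i j t') (powProj (dirOp V j t) n) := fun t' => by
        cases t'
        · exact hU hij n
        · exact hU hij.symm n
      have hsym' : dirSymbol U i j t * dirSymbol U i j (!t) = 1 := by
        cases t
        · exact h.mul_swap hij
        · exact h.mul_swap hij.symm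
      have hsymX : Commute (dirSymbol U i j (!t)) (dirOp V j t) := by
        cases t
        · exact h.commute_dirOp hij.symm j _
        · exact h.commute_dirOp hij j _
      have e1 := h.mul_dirOp hij t
      have e2 := h.mul_dirOp hij (!t)
      rw [powProj_succ, star_dirOp]
      set X := dirOp V j t
      set Y := dirOp V j (!t)
      set P := powProj X n
      set a := dirSymbol U i j t
      set b := dirSymbol U i j (!t)
      calc V i * (X * P * Y) = (V i * X) * P * Y := by simp only [mul_assoc]
        _ = a * X * (V i * P) * Y := by rw [e1]; simp only [mul_assoc]
        _ = a * X * P * (V i * Y) := by rw [ih.eq]; simp only [mul_assoc]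
        _ = a * (X * (P * b)) * Y * V i := by rw [e2]; simp only [mul_assoc]
        _ = (a * b) * X * P * Y * V i := by
          rw [← (hsym (!t)).eq, ← mul_assoc X, ← hsymX.eq]; simp only [mul_assoc]
        _ = X * P * Y * V i := by rw [hsym', one_mul]
  cases s
  · have h1 := (key n).star_star
    rw [star_powProj] at h1
    exact h1
  · exact key n

theorem powProj_commute (h : IsTwistedTuple U V) (i j : Fin N) (s t : Bool) (m n : ℕ) :
    Commute (powProj (dirOp V i s) m) (powProj (dirOp V j t) n) := by
  by_cases hij : i = j
  · subst hij
    by_cases hst : s = t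
    · subst hst
      exact (h.powerPartial i s).powProj_commute m n
    · have : s = !t := by cases s <;> cases t <;> simp_all
      subst this
      rw [← star_dirOp]
      exact (h.powerPartial i t).powProj_commute_star m n
  · have h1 := h.commute_powProj hij s t n
    have h2 := h.commute_powProj hij (!s) t n
    rw [← star_dirOp] at h2
    exact (h1.pow_left m).mul_left (h2.pow_left m)

end IsTwistedTuple

end Operators

/-! ### Joint level spaces of decreasing sequences of projections -/

section JointLevel

variable {H : Type*} [NormedAddCommGroup H] [InnerProductSpace ℂ H]

/-- The vectors that, for every `j`, are fixed by `P j n` for `n ≤ κ j` and annihilated by `P j n`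
for `n > κ j`. -/
def jointLevel {J : Type*} (P : J → ℕ → (H →L[ℂ] H)) (κ : J → ℕ∞) : Submodule ℂ H where
  carrier := {x | ∀ j n, P j n x = if (n : ℕ∞) ≤ κ j then x else 0}
  zero_mem' := fun j n => by simp
  add_mem' := fun {x y} hx hy j n => by
    rw [map_add, hx, hy]
    split_ifs <;> simp
  smul_mem' := fun a x hx j n => by
    rw [map_smul, hx]
    split_ifs <;> simp

variable {J : Type*} {P : J → ℕ → (H →L[ℂ] H)}

theorem mem_jointLevel {κ : J → ℕ∞} {x : H} :
    x ∈ jointLevel P κ ↔ ∀ j n, P j n x = if (n : ℕ∞) ≤ κ j then x else 0 := Iff.rfl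

theorem apply_of_mem_jointLevel {κ : J → ℕ∞} {x : H} (hx : x ∈ jointLevel P κ) {j : J} {n : ℕ}
    (h : (n : ℕ∞) ≤ κ j) : P j n x = x := by
  rw [hx j n, if_pos h]

theorem apply_eq_zero_of_mem_jointLevel {κ : J → ℕ∞} {x : H} (hx : x ∈ jointLevel P κ) {j : J}
    {n : ℕ} (h : κ j < n) : P j n x = 0 := by
  rw [hx j n, if_neg h.not_ge]

theorem isClosed_jointLevel (κ : J → ℕ∞) : IsClosed (jointLevel P κ : Set H) := by
  have : (jointLevel P κ : Set H) =
      ⋂ j, ⋂ n : ℕ, {x | P j n x = if (n : ℕ∞) ≤ κ j then x else 0} := by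
    ext x
    simp [mem_jointLevel]
  rw [this]
  refine isClosed_iInter fun j => isClosed_iInter fun n => ?_
  split_ifs
  · exact isClosed_eq (P j n).continuous continuous_id
  · exact isClosed_eq (P j n).continuous continuous_const

theorem map_mem_jointLevel {κ : J → ℕ∞} {A : H →L[ℂ] H} (hA : ∀ j n, Commute A (P j n)) {x : H}
    (hx : x ∈ jointLevel P κ) : A x ∈ jointLevel P κ := fun j n => by
  have h : P j n (A x) = A (P j n x) := (DFunLike.congr_fun (hA j n).eq x).symm
  rw [h, hx j n]
  split_ifs <;> simp

variable [CompleteSpace H]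

/-- At an index where the levels differ, the smaller one is a finite `a`, and the self-adjoint
projection number `a + 1` kills one vector and fixes the other. -/
theorem inner_eq_zero_of_ne (hstar : ∀ j n, star (P j n) = P j n) {κ κ' : J → ℕ∞} (hne : κ ≠ κ')
    {x y : H} (hx : x ∈ jointLevel P κ) (hy : y ∈ jointLevel P κ') : inner ℂ x y = 0 := by
  have hsymm : ∀ j n (x y : H), inner ℂ (P j n x) y = inner ℂ x (P j n y) := fun j n x y => by
    rw [← ContinuousLinearMap.adjoint_inner_left, ← ContinuousLinearMap.star_eq_adjoint, hstar]
  have key : ∀ {κ κ' : J → ℕ∞} {x y : H} (j : J), κ j < κ' j → x ∈ jointLevel P κ →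
      y ∈ jointLevel P κ' → inner ℂ x y = 0 := by
    intro κ κ' x y j hlt hx hy
    lift κ j to ℕ using hlt.ne_top with a ha
    have h1 : P j (a + 1) x = 0 := apply_eq_zero_of_mem_jointLevel hx (by
      rw [← ha]; exact_mod_cast a.lt_succ_self)
    have h2 : P j (a + 1) y = y := apply_of_mem_jointLevel hy (by
      push_cast; exact Order.add_one_le_of_lt hlt)
    rw [← h2, ← hsymm, h1, inner_zero_left]
  obtain ⟨j, hj⟩ := Function.ne_iff.1 hne
  rcases lt_or_gt_of_ne hj with hlt | hlt
  · exact key j hlt hx hy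
  · rw [inner_eq_zero_symm]
    exact key j hlt hy hx

/-- A vector that is orthogonal to all joint level spaces of finitely many commuting decreasing
sequences of projections, each starting with the identity, is zero. -/
theorem eq_zero_of_orthogonal_jointLevel [Finite J] (hstar : ∀ j n, star (P j n) = P j n)
    (hzero : ∀ j, P j 0 = 1) (hmul : ∀ j m n, m ≤ n → P j m * P j n = P j n)
    (hcomm : ∀ i j m n, Commute (P i m) (P j n)) {x : H}
    (hx : ∀ κ, ∀ y ∈ jointLevel P κ, inner ℂ x y = 0) : x = 0 := by
  classical
  have := Fintype.ofFinite J
  have hmul' : ∀ j m n, m ≤ n → P j n * P j m = P j n := fun j m n h => by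
    rw [(hcomm j j n m).eq, hmul j m n h]
  let S : Finset J → (J → ℕ∞) → Submodule ℂ H := fun t κ =>
    jointLevel (fun j : t => P j) (fun j => κ j)
  have hS : ∀ t κ y, y ∈ S t κ ↔ ∀ j ∈ t, ∀ n, P j n y = if (n : ℕ∞) ≤ κ j then y else 0 :=
    fun t κ y => ⟨fun h j hj => h ⟨j, hj⟩, fun h j => h j j.2⟩
  -- The constraints are dropped one index at a time: `x` is orthogonal to every space constrained
  -- only on the complement of `t`. For `t = univ` no constraint is left.
  have key : ∀ t : Finset J, ∀ κ, ∀ y ∈ S tᶜ κ, inner ℂ x y = 0 := by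
    intro t
    induction t using Finset.induction_on with
    | empty =>
      intro κ y hy
      rw [hS] at hy
      exact hx κ y fun j n => hy j (by simp) n
    | insert i t hi ih =>
      intro κ
      set s := (insert i t)ᶜ with hs
      have hts : tᶜ = insert i s := by
        ext j
        by_cases hj : j = i
        · simp [hj, hi]
        · simp [hs, hj]
      have his : i ∉ s := by simp [hs]
      have : CompleteSpace (S s κ) := (isClosed_jointLevel _).completeSpace_coe
      -- It is enough to show that this projection of `x` vanishes. By induction `y` is orthogonal
      -- to every vector of `S s κ` that also has a definite level at `i`.
      set y : H := (S s κ).starProjection x with hy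
      have hyS : y ∈ S s κ := Submodule.starProjection_apply_mem _ _
      have hxy : ∀ z ∈ S s κ, inner ℂ x z = inner ℂ y z := fun z hz => by
        have := Submodule.sub_starProjection_mem_orthogonal (K := S s κ) x
        have := Submodule.inner_left_of_mem_orthogonal hz this
        rwa [inner_sub_left, sub_eq_zero] at this
      have hPS : ∀ n z, z ∈ S s κ → P i n z ∈ S s κ := fun n z hz =>
        map_mem_jointLevel (fun j m => hcomm _ _ _ _) hz
      have horth : ∀ (a : ℕ∞) (z : H), z ∈ S s κ →
          (∀ n, P i n z = if (n : ℕ∞) ≤ a then z else 0) → inner ℂ y z = 0 := by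
        intro a z hz hza
        rw [← hxy z hz]
        refine ih (Function.update κ i a) z ?_
        rw [hS, hts]
        intro j hj n
        by_cases hji : j = i
        · subst hji
          simpa using hza n
        · rw [Function.update_of_ne hji]
          exact (hS _ _ _).1 hz j (Finset.mem_of_mem_insert_of_ne hj hji) n
      have hstep : ∀ n, P i n y = P i (n + 1) y := by
        intro n
        -- `D` projects onto level exactly `n` at `i`, so `D y` is orthogonal to `y`; since `D* D =
        -- D`, this says `‖D y‖² = 0`.
        set D := P i n - P i (n + 1) with hD
        have hDD : star D * D = D := by
          rw [hD, star_sub, hstar, hstar, sub_mul, mul_sub, mul_sub, hmul i n n le_rfl,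
            hmul i n _ n.le_succ, hmul' i n _ n.le_succ, hmul i _ _ le_rfl]
          abel
        have h0 : inner ℂ y (D y) = 0 := by
          refine horth n (D y) (Submodule.sub_mem _ (hPS _ _ hyS) (hPS _ _ hyS)) fun m => ?_
          by_cases hm : m ≤ n
          · rw [if_pos (by exact_mod_cast hm)]
            change (P i m * D) y = D y
            rw [hD, mul_sub, hmul i m n hm, hmul i m _ (hm.trans n.le_succ)]
          · rw [if_neg (by exact_mod_cast hm)]
            change (P i m * D) y = 0
            rw [hD, mul_sub, hmul' i n m (by omega), hmul' i (n + 1) m (by omega), sub_self]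
            rfl
        have h1 : inner ℂ (D y) (D y) = 0 := by
          rw [← ContinuousLinearMap.adjoint_inner_right, ← ContinuousLinearMap.star_eq_adjoint]
          change inner ℂ y ((star D * D) y) = 0
          rw [hDD, h0]
        exact sub_eq_zero.1 (inner_self_eq_zero.1 h1)
      have hfix : ∀ n, P i n y = y := by
        intro n
        induction n with
        | zero => rw [hzero]; rfl
        | succ n ihn => rw [← hstep, ihn]
      -- Now `y` is fixed by all `P i n`, so it has level `⊤` at `i` and is orthogonal to itself.
      have hy0 : y = 0 :=
        inner_self_eq_zero.1 (horth ⊤ y hyS fun n => by rw [if_pos le_top, hfix])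
      intro z hz
      rw [hxy z hz, hy0, inner_zero_left]
  exact inner_self_eq_zero.1 (key Finset.univ 0 x (by rw [hS]; simp))

end JointLevel

/-! ### Levels of the basis vectors of the slots -/

namespace SlotType

/-- The number of times that the adjoint (for `true`) or the slot operator itself (for `false`) can
be applied to a basis vector before it vanishes. -/
def level : (c : SlotType) → Bool → c.Idx → ℕ∞
  | u, _, _ => ⊤
  | s, true, k => ((show ℕ from k : ℕ) : ℕ∞)
  | s, false, _ => ⊤
  | b, true, _ => ⊤
  | b, false, k => ((show ℕ from k : ℕ) : ℕ∞)
  | trunc _, true, k => ((k.val : ℕ) : ℕ∞)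
  | trunc p, false, k => ((p - 1 - k.val : ℕ) : ℕ∞)

/-- The label of the cyclic basis vector. -/
def base : (c : SlotType) → c.Idx
  | u => ()
  | s => (0 : ℕ)
  | b => (0 : ℕ)
  | trunc p => ⟨0, p.pos⟩

/-- Whether the slot operator (`true`) or its adjoint (`false`) generates the basis. -/
def dir : SlotType → Bool
  | b => false
  | _ => true

/-- This and the next lemma match the levels in the model with the shift by `exponent` that a power
of the generating operator causes. -/
theorem level_dir (c : SlotType) (k : c.Idx) :
    c.level c.dir k = c.level c.dir c.base + c.exponent k := by
  cases c <;> simp [level, dir, base, exponent]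

theorem level_not_dir (c : SlotType) (k : c.Idx) :
    c.level (!c.dir) c.base = c.level (!c.dir) k + c.exponent k := by
  cases c with
  | trunc p =>
    have hk : k.val < p := k.isLt
    simp only [level, dir, base, exponent, Bool.not_true]
    norm_cast
    omega
  | _ => simp [level, dir, base, exponent]

/-- This lemma and `sigma_eq_of_level_eq` make pairs of levels correspond bijectively to types with
a basis vector; hence the four kinds of slot exhaust all possibilities and none is counted twice. -/
theorem exists_level_eq (a b : ℕ∞) :
    ∃ (c : SlotType) (k : c.Idx), c.level true k = a ∧ c.level false k = b := by
  induction a using ENat.recTopCoe with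
  | top =>
    induction b using ENat.recTopCoe with
    | top => exact ⟨u, (), rfl, rfl⟩
    | coe m => exact ⟨SlotType.b, m, rfl, rfl⟩
  | coe n =>
    induction b using ENat.recTopCoe with
    | top => exact ⟨s, n, rfl, rfl⟩
    | coe m =>
      refine ⟨trunc ⟨n + m + 1, Nat.succ_pos _⟩, ⟨n, ?_⟩, rfl, ?_⟩
      · change n < n + m + 1
        omega
      · change ((n + m + 1 - 1 - n : ℕ) : ℕ∞) = m
        congr 1
        omega

theorem sigma_eq_of_level_eq {c c' : SlotType} {k : c.Idx} {k' : c'.Idx}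
    (h : ∀ t, c.level t k = c'.level t k') : (⟨c, k⟩ : Σ c : SlotType, c.Idx) = ⟨c', k'⟩ := by
  have h1 := h true
  have h2 := h false
  rcases c with _ | _ | _ | p <;> rcases c' with _ | _ | _ | p'
  case trunc.trunc =>
    have hk : k.val < p := k.isLt
    have hk' : k'.val < p' := k'.isLt
    simp only [level] at h1 h2
    norm_cast at h1 h2
    have hp : p = p' := PNat.coe_injective (by omega)
    subst hp
    have : k = k' := Fin.ext h1
    rw [this]
  case u.u => rfl
  case s.s =>
    have : k = k' := ENat.natCast_inj.1 h1
    rw [this]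
  case b.b =>
    have : k = k' := ENat.natCast_inj.1 h2
    rw [this]
  all_goals first
    | exact absurd h1 (ENat.natCast_ne_top _)
    | exact absurd h1.symm (ENat.natCast_ne_top _)
    | exact absurd h2 (ENat.natCast_ne_top _)
    | exact absurd h2.symm (ENat.natCast_ne_top _)

end SlotType

/-! ### Monomials in a twisted tuple -/

section Monomials

variable {H : Type*} [NormedAddCommGroup H] [InnerProductSpace ℂ H] [CompleteSpace H] {N : ℕ}

/-- The range projections of the powers of `V j` (for `true`) and of `(V j)*` (for `false`). -/
def rangeProj (V : Fin N → (H →L[ℂ] H)) (p : Fin N × Bool) (n : ℕ) : H →L[ℂ] H :=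
  powProj (dirOp V p.1 p.2) n

/-- The levels of the basis vector `e_k` of the model. -/
def modelLevel (c : Fin N → SlotType) (k : MultiIdx c) (p : Fin N × Bool) : ℕ∞ :=
  (c p.1).level p.2 (k p.1)

/-- The subspace that corresponds to `e_k ⊗ M` in the model. -/
def levelSpace (V : Fin N → (H →L[ℂ] H)) (c : Fin N → SlotType) (k : MultiIdx c) :
    Submodule ℂ H :=
  jointLevel (rangeProj V) (modelLevel c k)

/-- The label of the cyclic basis vector of the model. -/
def baseIdx (c : Fin N → SlotType) : MultiIdx c := fun j => (c j).base

/-- `k` on the slots in `l`, the base label elsewhere. -/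
def partialIdx (c : Fin N → SlotType) (k : MultiIdx c) (l : List (Fin N)) : MultiIdx c :=
  fun j => if j ∈ l then k j else (c j).base

/-- The part with slots in `l` of the monomial that sends `e_0 ⊗ η` to `e_k ⊗ η`. -/
def monomial (V : Fin N → (H →L[ℂ] H)) (c : Fin N → SlotType) (k : MultiIdx c)
    (l : List (Fin N)) : H →L[ℂ] H :=
  (l.map fun j => dirOp V j (c j).dir ^ (c j).exponent (k j)).prod

open Classical in
/-- The product of the factors that `V n` picks up in the slots in `l` that satisfy `P`. -/
def symbolProd (U : Fin N → Fin N → (H →L[ℂ] H)) (c : Fin N → SlotType) (k : MultiIdx c)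
    (n : Fin N) (P : Fin N → Prop) (l : List (Fin N)) : H →L[ℂ] H :=
  ((l.filter fun m => P m).map fun m =>
    dirSymbol U n m (c m).dir ^ (c m).exponent (k m)).prod

theorem modelLevel_injective {c c' : Fin N → SlotType} {k : MultiIdx c} {k' : MultiIdx c'}
    (h : modelLevel c k = modelLevel c' k') :
    (⟨c, k⟩ : Σ c : Fin N → SlotType, MultiIdx c) = ⟨c', k'⟩ := by
  have hs : ∀ j, (⟨c j, k j⟩ : Σ c : SlotType, c.Idx) = ⟨c' j, k' j⟩ := fun j =>
    SlotType.sigma_eq_of_level_eq fun t => congrFun h (j, t)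
  have hc : c = c' := funext fun j => congrArg Sigma.fst (hs j)
  subst hc
  have hk : k = k' := funext fun j => eq_of_heq (Sigma.mk.inj (hs j)).2
  rw [hk]

theorem exists_modelLevel_eq (κ : Fin N × Bool → ℕ∞) :
    ∃ (c : Fin N → SlotType) (k : MultiIdx c), modelLevel c k = κ := by
  choose c k h1 h2 using fun j => SlotType.exists_level_eq (κ (j, true)) (κ (j, false))
  refine ⟨c, k, funext fun p => ?_⟩
  obtain ⟨j, t⟩ := p
  cases t
  · exact h2 j
  · exact h1 j

theorem star_rangeProj (V : Fin N → (H →L[ℂ] H)) (p : Fin N × Bool) (n : ℕ) :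
    star (rangeProj V p n) = rangeProj V p n := star_powProj _ _

theorem isClosed_levelSpace (V : Fin N → (H →L[ℂ] H)) (c : Fin N → SlotType) (k : MultiIdx c) :
    IsClosed (levelSpace V c k : Set H) := isClosed_jointLevel _

theorem inner_levelSpace_eq_zero {V : Fin N → (H →L[ℂ] H)} {c c' : Fin N → SlotType}
    {k : MultiIdx c} {k' : MultiIdx c'}
    (hne : (⟨c, k⟩ : Σ c : Fin N → SlotType, MultiIdx c) ≠ ⟨c', k'⟩) {x y : H}
    (hx : x ∈ levelSpace V c k) (hy : y ∈ levelSpace V c' k') : inner ℂ x y = 0 :=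
  inner_eq_zero_of_ne (star_rangeProj V) (fun h => hne (modelLevel_injective h)) hx hy

theorem monomial_cons (V : Fin N → (H →L[ℂ] H)) (c : Fin N → SlotType) (k : MultiIdx c)
    (a : Fin N) (l : List (Fin N)) :
    monomial V c k (a :: l) = dirOp V a (c a).dir ^ (c a).exponent (k a) * monomial V c k l :=
  rfl

theorem monomial_append (V : Fin N → (H →L[ℂ] H)) (c : Fin N → SlotType) (k : MultiIdx c)
    (l l' : List (Fin N)) :
    monomial V c k (l ++ l') = monomial V c k l * monomial V c k l' := by
  simp [monomial]

theorem monomial_congr (V : Fin N → (H →L[ℂ] H)) (c : Fin N → SlotType) {k k' : MultiIdx c}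
    {l : List (Fin N)} (h : ∀ j ∈ l, k j = k' j) : monomial V c k l = monomial V c k' l := by
  rw [monomial, monomial, List.map_congr_left fun j hj => by rw [h j hj]]

omit [CompleteSpace H] in
theorem symbolProd_append (U : Fin N → Fin N → (H →L[ℂ] H)) (c : Fin N → SlotType)
    (k : MultiIdx c) (n : Fin N) (P : Fin N → Prop) (l l' : List (Fin N)) :
    symbolProd U c k n P (l ++ l') = symbolProd U c k n P l * symbolProd U c k n P l' := by
  simp [symbolProd]

omit [CompleteSpace H] in
theorem symbolProd_eq_one (U : Fin N → Fin N → (H →L[ℂ] H)) (c : Fin N → SlotType)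
    (k : MultiIdx c) (n : Fin N) {P : Fin N → Prop} {l : List (Fin N)} (h : ∀ m ∈ l, ¬ P m) :
    symbolProd U c k n P l = 1 := by
  rw [symbolProd, List.filter_eq_nil_iff.2 fun m hm => by simpa using h m hm]
  rfl

theorem partialIdx_finRange (c : Fin N → SlotType) (k : MultiIdx c) :
    partialIdx c k (List.finRange N) = k := by
  funext j
  simp [partialIdx]

theorem commute_monomial {V : Fin N → (H →L[ℂ] H)} {A : H →L[ℂ] H}
    (hA : ∀ j t, Commute A (dirOp V j t)) (c : Fin N → SlotType) (k : MultiIdx c)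
    (l : List (Fin N)) : Commute A (monomial V c k l) := by
  refine Commute.list_prod_right _ _ fun x hx => ?_
  obtain ⟨j, -, rfl⟩ := List.mem_map.1 hx
  exact (hA j _).pow_right _

/-- The action of the slot operator on the orbit of a cyclic vector. -/
theorem PowerPartial.apply_orbit_of_source {v : Bool → (H →L[ℂ] H)} (hv : ∀ t, PowerPartial (v t))
    (hstar : ∀ t, star (v t) = v (!t)) {c : SlotType} (hc : c ≠ SlotType.u) {k l : c.Idx}
    (hs : c.source k = some l) {x : H}
    (hx : ∀ t (m : ℕ), (m : ℕ∞) ≤ c.level t c.base → powProj (v t) m x = x) :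
    v true ((v c.dir ^ c.exponent l) x) = (v c.dir ^ c.exponent k) x := by
  have hsucc : ∀ e, v true ((v true ^ e) x) = (v true ^ (e + 1)) x := fun e => by
    rw [pow_succ']
    rfl
  -- Here `v v*^(e+1) = P_1 v*^e = v*^e P_{1+e}`, with `P` the range projections of `v`. The
  -- condition on `x` holds for every `e` in a backward slot, whose level for `true` is `⊤`.
  have hpred : ∀ e, powProj (v true) (1 + e) x = x →
      v true ((v false ^ (e + 1)) x) = (v false ^ e) x := fun e he => by
    have h1 := (hv false).powProj_star_mul_pow 1 e
    rw [hstar, Bool.not_false] at h1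
    have h2 : powProj (v true) 1 = v true * v false := by
      rw [powProj, pow_one, pow_one, hstar, Bool.not_true]
    rw [pow_succ', mul_apply_eq_comp, ← mul_apply_eq_comp (v true), ← h2,
      ← mul_apply_eq_comp, h1, mul_apply_eq_comp, he]
  cases c with
  | u => exact absurd rfl hc
  | s =>
    obtain rfl : Nat.succ l = k := Nat.ppred_eq_some.1 hs
    exact hsucc _
  | b =>
    obtain rfl : Nat.succ k = l := Option.some.inj hs
    exact hpred k (hx true _ le_top)
  | trunc p =>
    simp only [SlotType.source] at hs
    split_ifs at hs with hk
    have h1 : k.val = l.val + 1 := by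
      have := congrArg Fin.val (Option.some.inj hs)
      simp only at this
      omega
    change v true ((v true ^ l.val) x) = (v true ^ k.val) x
    rw [h1, hsucc]

/-- Only `e_0` of a backward shift and the last vector of a truncated shift have no successor. In
both cases the result is `v ^ (e + 1)` on a vector whose level for `star v` is `e`, and `v ^ (e +
1)` absorbs the projection that kills this vector. -/
theorem PowerPartial.apply_orbit_of_forall_source_ne {v : Bool → (H →L[ℂ] H)}
    (hv : ∀ t, PowerPartial (v t)) (hstar : ∀ t, star (v t) = v (!t)) {c : SlotType} {l : c.Idx}
    (hs : ∀ k, c.source k ≠ some l) {x : H}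
    (hx : ∀ (m : ℕ), c.level false c.base < m → powProj (v false) m x = 0) :
    v true ((v c.dir ^ c.exponent l) x) = 0 := by
  have key : ∀ e : ℕ, c.level false c.base < ((e + 1 : ℕ) : ℕ∞) → (v true ^ (e + 1)) x = 0 :=
    fun e he => by
    have h1 := (hv true).pow_mul_powProj_star (e + 1)
    rw [hstar, Bool.not_true] at h1
    rw [← h1, mul_apply_eq_comp, hx _ he, map_zero]
  cases c with
  | u => exact absurd rfl (hs l)
  | s => exact absurd (Nat.ppred_succ (n := l)) (hs (Nat.succ l))
  | b =>
    have hl : l = (0 : ℕ) := by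
      by_contra hl
      refine hs (Nat.pred l) (congrArg some ?_)
      exact Nat.succ_pred hl
    subst hl
    simpa [SlotType.exponent] using key 0 (by simp [SlotType.level, SlotType.base])
  | trunc p =>
    have hl : l.val + 1 = p := by
      by_contra hne
      have hlp : l.val < p := l.isLt
      refine hs ⟨l.val + 1, by omega⟩ ?_
      simp only [SlotType.source, Nat.succ_pos, if_true]
      rfl
    have h2 : v true ((v true ^ l.val) x) = (v true ^ (l.val + 1)) x := by
      rw [pow_succ']
      rfl
    change v true ((v true ^ l.val) x) = 0
    rw [h2]
    refine key _ ?_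
    simp only [SlotType.level, SlotType.base]
    norm_cast
    omega

/-! ### Monomials as isometries between level spaces, and their relations with `V n` -/

namespace IsTwistedTuple

variable {U : Fin N → Fin N → (H →L[ℂ] H)} {V : Fin N → (H →L[ℂ] H)}

/-- The levels at `j` shift in opposite senses by `powProj_add_mul_pow` and `powProj_star_mul_pow`,
and those at other indices stay because their projections commute with the operator. The adjoint
power inverts the move since the opposite level of `x` is at least `e`. -/
theorem pow_dirOp_mem_jointLevel (h : IsTwistedTuple U V) {κ κ' : Fin N × Bool → ℕ∞} {j : Fin N}
    {t : Bool} {e : ℕ} (h1 : κ' (j, t) = κ (j, t) + e) (h2 : κ (j, !t) = κ' (j, !t) + e)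
    (h3 : ∀ i, i ≠ j → ∀ s, κ' (i, s) = κ (i, s)) {x : H}
    (hx : x ∈ jointLevel (rangeProj V) κ) :
    (dirOp V j t ^ e) x ∈ jointLevel (rangeProj V) κ' ∧
      (dirOp V j (!t) ^ e) ((dirOp V j t ^ e) x) = x := by
  have hX := h.powerPartial j t
  constructor
  · rintro ⟨i, s⟩ m
    rw [← mul_apply_eq_comp]
    by_cases hij : i = j
    · subst hij
      by_cases hst : s = t
      · subst hst
        rw [h1]
        -- For `m ≤ e` the range of the power already lies in the range of the projection, whatever
        -- the level of `x`.
        rcases le_total m e with hm | hm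
        · have : rangeProj V (i, s) m * dirOp V i s ^ e = dirOp V i s ^ e := by
            rw [← hX.powProj_mul_pow, ← mul_assoc]
            congr 1
            exact hX.powProj_mul_of_le hm
          rw [this, if_pos]
          exact le_add_left (by exact_mod_cast hm)
        · obtain ⟨n, rfl⟩ := Nat.exists_eq_add_of_le' hm
          have : rangeProj V (i, s) (n + e) * dirOp V i s ^ e
              = dirOp V i s ^ e * rangeProj V (i, s) n := hX.powProj_add_mul_pow n e
          rw [this, mul_apply_eq_comp, hx]
          have : ((n + e : ℕ) : ℕ∞) ≤ κ (i, s) + e ↔ (n : ℕ∞) ≤ κ (i, s) := by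
            push_cast
            exact ENat.add_le_add_iff_right (ENat.natCast_ne_top e)
          simp only [this]
          split_ifs <;> simp
      · have hs : s = !t := by cases s <;> cases t <;> simp_all
        subst hs
        have : rangeProj V (i, !t) m * dirOp V i t ^ e
            = dirOp V i t ^ e * rangeProj V (i, !t) (m + e) := by
          simp only [rangeProj, ← star_dirOp]
          exact hX.powProj_star_mul_pow m e
        rw [this, mul_apply_eq_comp, hx]
        have : ((m + e : ℕ) : ℕ∞) ≤ κ (i, !t) ↔ (m : ℕ∞) ≤ κ' (i, !t) := by
          rw [h2]
          push_cast
          exact ENat.add_le_add_iff_right (ENat.natCast_ne_top e)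
        simp only [this]
        split_ifs <;> simp
    · have := (h.commute_powProj (Ne.symm hij) t s m).pow_left e
      rw [rangeProj, ← this.eq, mul_apply_eq_comp]
      have h4 : powProj (dirOp V i s) m x = _ := hx (i, s) m
      rw [h4, h3 i hij]
      split_ifs <;> simp
  · have h4 : rangeProj V (j, !t) e x = x :=
      apply_of_mem_jointLevel hx (by rw [h2]; exact le_add_self)
    rw [rangeProj, powProj, star_dirOp, Bool.not_not] at h4
    exact h4

theorem pow_dirOp_mem_levelSpace (h : IsTwistedTuple U V) {c : Fin N → SlotType}
    {k k' : MultiIdx c} {j : Fin N} (hj : k j = (c j).base) (hk : ∀ i, i ≠ j → k' i = k i) {x : H}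
    (hx : x ∈ levelSpace V c k) :
    (dirOp V j (c j).dir ^ (c j).exponent (k' j)) x ∈ levelSpace V c k' ∧
      (dirOp V j (!(c j).dir) ^ (c j).exponent (k' j))
        ((dirOp V j (c j).dir ^ (c j).exponent (k' j)) x) = x := by
  refine h.pow_dirOp_mem_jointLevel ?_ ?_ ?_ hx
  · simp only [modelLevel, hj]
    exact SlotType.level_dir _ _
  · simp only [modelLevel, hj]
    exact SlotType.level_not_dir _ _
  · intro i hi s
    simp only [modelLevel, hk i hi]

theorem pow_dirOp_mem_levelSpace_base (h : IsTwistedTuple U V) {c : Fin N → SlotType}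
    {k k' : MultiIdx c} {j : Fin N} (hj : k j = (c j).base) (hk : ∀ i, i ≠ j → k' i = k i) {x : H}
    (hx : x ∈ levelSpace V c k') :
    (dirOp V j (!(c j).dir) ^ (c j).exponent (k' j)) x ∈ levelSpace V c k ∧
      (dirOp V j (c j).dir ^ (c j).exponent (k' j))
        ((dirOp V j (!(c j).dir) ^ (c j).exponent (k' j)) x) = x := by
  have := h.pow_dirOp_mem_jointLevel (κ := modelLevel c k') (κ' := modelLevel c k)
    (j := j) (t := !(c j).dir) (e := (c j).exponent (k' j)) ?_ ?_ ?_ hx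
  · rwa [Bool.not_not] at this
  · simp only [modelLevel, hj]
    exact SlotType.level_not_dir _ _
  · simp only [modelLevel, hj, Bool.not_not]
    exact SlotType.level_dir _ _
  · intro i hi s
    simp only [modelLevel, hk i hi]

theorem norm_eq_of_star_apply {A B : H →L[ℂ] H} (hAB : star A = B) {x : H} (hx : B (A x) = x) :
    ‖A x‖ = ‖x‖ := by
  have h1 : inner ℂ (A x) (A x) = inner ℂ x x := by
    rw [← ContinuousLinearMap.adjoint_inner_right, ← ContinuousLinearMap.star_eq_adjoint, hAB, hx]
  rw [@norm_eq_sqrt_re_inner ℂ _ _ _ _ (A x), h1, ← norm_eq_sqrt_re_inner]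

theorem partialIdx_cons_apply_of_ne (c : Fin N → SlotType) (k : MultiIdx c) {a i : Fin N}
    (l : List (Fin N)) (hi : i ≠ a) : partialIdx c k (a :: l) i = partialIdx c k l i := by
  simp [partialIdx, hi]

/-- Each factor moves one slot from its base label to `k`. `Nodup` guarantees that the slot is still
at its base when its factor acts, and the adjoint power undoes the step, so norms are preserved. -/
theorem monomial_mem_levelSpace (h : IsTwistedTuple U V) {c : Fin N → SlotType} (k : MultiIdx c)
    {l : List (Fin N)} (hl : l.Nodup) {x : H} (hx : x ∈ levelSpace V c (baseIdx c)) :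
    monomial V c k l x ∈ levelSpace V c (partialIdx c k l) ∧ ‖monomial V c k l x‖ = ‖x‖ := by
  induction l with
  | nil =>
    have : partialIdx c k [] = baseIdx c := by
      funext j
      simp [partialIdx, baseIdx]
    rw [this]
    exact ⟨hx, rfl⟩
  | cons a l ih =>
    obtain ⟨ha, hl⟩ := List.nodup_cons.1 hl
    obtain ⟨h1, h2⟩ := ih hl
    have hk : partialIdx c k (a :: l) a = k a := by simp [partialIdx]
    have h3 := h.pow_dirOp_mem_levelSpace (k := partialIdx c k l) (k' := partialIdx c k (a :: l))
      (j := a) (by simp [partialIdx, ha]) (fun i hi => partialIdx_cons_apply_of_ne c k l hi) h1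
    rw [hk] at h3
    refine ⟨h3.1, ?_⟩
    rw [← h2, monomial_cons, mul_apply_eq_comp]
    exact norm_eq_of_star_apply (by rw [star_pow, star_dirOp]) h3.2

/-- Surjectivity: the adjoint powers bring the slots back to their base labels one by one. -/
theorem exists_monomial_eq (h : IsTwistedTuple U V) {c : Fin N → SlotType} (k : MultiIdx c)
    {l : List (Fin N)} (hl : l.Nodup) {y : H} (hy : y ∈ levelSpace V c (partialIdx c k l)) :
    ∃ x ∈ levelSpace V c (baseIdx c), monomial V c k l x = y := by
  induction l generalizing y with
  | nil =>
    have : partialIdx c k [] = baseIdx c := by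
      funext j
      simp [partialIdx, baseIdx]
    rw [this] at hy
    exact ⟨y, hy, rfl⟩
  | cons a l ih =>
    obtain ⟨ha, hl⟩ := List.nodup_cons.1 hl
    have hk : partialIdx c k (a :: l) a = k a := by simp [partialIdx]
    have h3 := h.pow_dirOp_mem_levelSpace_base (k := partialIdx c k l)
      (k' := partialIdx c k (a :: l)) (j := a) (by simp [partialIdx, ha])
      (fun i hi => partialIdx_cons_apply_of_ne c k l hi) hy
    rw [hk] at h3
    obtain ⟨x, hx, hxy⟩ := ih hl h3.1
    refine ⟨x, hx, ?_⟩
    rw [monomial_cons, mul_apply_eq_comp, hxy, h3.2]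

theorem dirSymbol_commute_dirOp (h : IsTwistedTuple U V) {n m : Fin N} (hnm : n ≠ m) (t : Bool)
    (j : Fin N) (s : Bool) : Commute (dirSymbol U n m t) (dirOp V j s) := by
  cases t
  · exact h.commute_dirOp hnm j s
  · exact h.commute_dirOp hnm.symm j s

theorem symbolProd_commute_dirOp (h : IsTwistedTuple U V) (c : Fin N → SlotType) (k : MultiIdx c)
    {n : Fin N} {P : Fin N → Prop} (hP : ∀ m, P m → n ≠ m) (l : List (Fin N)) (j : Fin N)
    (s : Bool) : Commute (symbolProd U c k n P l) (dirOp V j s) := by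
  refine Commute.list_prod_left _ _ fun x hx => ?_
  obtain ⟨m, hm, rfl⟩ := List.mem_map.1 hx
  have hPm : P m := by simpa using (List.mem_filter.1 hm).2
  exact (h.dirSymbol_commute_dirOp (hP m hPm) _ j s).pow_left _

theorem mul_pow_dirOp (h : IsTwistedTuple U V) {n m : Fin N} (hnm : n ≠ m) (t : Bool) (e : ℕ) :
    V n * dirOp V m t ^ e = dirSymbol U n m t ^ e * dirOp V m t ^ e * V n := by
  have h1 := h.dirSymbol_commute_dirOp hnm t m t
  rw [← h1.mul_pow]
  exact ((show SemiconjBy (V n) _ _ from h.mul_dirOp hnm t).pow_right e).eq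

/-- Moving `V n` past a monomial. -/
theorem mul_monomial (h : IsTwistedTuple U V) (c : Fin N → SlotType) (k : MultiIdx c) {n : Fin N}
    {P : Fin N → Prop} (hP : ∀ m, P m → n ≠ m) {l : List (Fin N)}
    (hl : ∀ m ∈ l, ¬ P m → (c m).exponent (k m) = 0) :
    V n * monomial V c k l = monomial V c k l * symbolProd U c k n P l * V n := by
  induction l with
  | nil => simp [monomial, symbolProd]
  | cons a l ih =>
    have ih := ih fun m hm => hl m (List.mem_cons_of_mem _ hm)
    rw [monomial_cons]
    -- Slots outside `P` have exponent zero, so their factor is the identity. This lets `n` itself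
    -- occur in `l`, although there is no commutation rule for `V n` with its own powers.
    by_cases ha : P a
    · have h1 : symbolProd U c k n P (a :: l) =
          dirSymbol U n a (c a).dir ^ (c a).exponent (k a) * symbolProd U c k n P l := by
        simp [symbolProd, ha]
      have h2 : Commute (dirSymbol U n a (c a).dir ^ (c a).exponent (k a)) (monomial V c k l) :=
        (commute_monomial (h.dirSymbol_commute_dirOp (hP a ha) _) c k l).pow_left _
      have h3 := (h.dirSymbol_commute_dirOp (hP a ha) (c a).dir a (c a).dir).pow_pow
        ((c a).exponent (k a)) ((c a).exponent (k a))
      rw [h1, ← mul_assoc, h.mul_pow_dirOp (hP a ha), mul_assoc _ (V n), ih, h3.eq]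
      simp only [mul_assoc]
      rw [← mul_assoc _ (monomial V c k l), h2.eq]
      simp only [mul_assoc]
    · have h1 : symbolProd U c k n P (a :: l) = symbolProd U c k n P l := by
        simp [symbolProd, ha]
      rw [h1, hl a List.mem_cons_self ha, pow_zero, one_mul, ih]

theorem exponent_eq_zero_of_eq_u {c : SlotType} (hc : c = SlotType.u) (k : c.Idx) :
    c.exponent k = 0 := by
  subst hc
  rfl

theorem apply_monomial_of_eq_u (h : IsTwistedTuple U V) (c : Fin N → SlotType) (k : MultiIdx c)
    {n : Fin N} (hn : c n = SlotType.u) (x : H) :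
    V n (monomial V c k (List.finRange N) x) = monomial V c k (List.finRange N)
      (symbolProd U c k n (fun m => c m ≠ SlotType.u) (List.finRange N) (V n x)) :=
  DFunLike.congr_fun (h.mul_monomial c k (P := fun m => c m ≠ SlotType.u)
    (fun _ hm hnm => hm (hnm ▸ hn)) (l := List.finRange N)
    fun _ _ hm => exponent_eq_zero_of_eq_u (not_not.1 hm) _) x

theorem exists_finRange_eq_append (n : Fin N) : ∃ l₁ l₂ : List (Fin N),
    List.finRange N = l₁ ++ n :: l₂ ∧ (∀ m ∈ l₁, m < n) ∧ ∀ m ∈ l₂, n < m := by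
  obtain ⟨l₁, l₂, hl⟩ := List.append_of_mem (List.mem_finRange n)
  have hp : (List.finRange N).Pairwise (· < ·) := List.pairwise_lt_finRange N
  rw [hl, List.pairwise_append, List.pairwise_cons] at hp
  exact ⟨l₁, l₂, hl, fun m hm => hp.2.2 m hm n List.mem_cons_self, hp.2.1.1⟩

/-- Moving `V n` past the slots that precede the slot `n`. -/
theorem apply_monomial_of_ne_u (h : IsTwistedTuple U V) (c : Fin N → SlotType) {k k' : MultiIdx c}
    {n : Fin N} (hk : ∀ j, j ≠ n → k j = k' j) {l₁ l₂ : List (Fin N)}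
    (hl : List.finRange N = l₁ ++ n :: l₂) (h₁ : ∀ m ∈ l₁, m < n) (h₂ : ∀ m ∈ l₂, n < m) :
    V n * monomial V c k (List.finRange N) = monomial V c k' l₁ *
      symbolProd U c k' n (fun m => c m ≠ SlotType.u ∧ m < n) (List.finRange N) *
      (V n * dirOp V n (c n).dir ^ (c n).exponent (k n)) * monomial V c k' l₂ := by
  -- Slots from `n` onwards fail `m < n`, so the product over all slots is the product over `l₁`.
  have hsym : symbolProd U c k' n (fun m => c m ≠ SlotType.u ∧ m < n) (List.finRange N) =
      symbolProd U c k' n (fun m => c m ≠ SlotType.u ∧ m < n) l₁ := by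
    rw [hl, symbolProd_append, symbolProd_eq_one U c k' n (l := n :: l₂), mul_one]
    rintro m hm ⟨-, hmn⟩
    rcases List.mem_cons.1 hm with rfl | hm
    · exact lt_irrefl _ hmn
    · exact (h₂ m hm).not_gt hmn
  rw [hsym, hl, monomial_append, monomial_cons, ← mul_assoc,
    monomial_congr V c (k := k) (k' := k') (l := l₁) fun j hj => hk j (h₁ j hj).ne,
    monomial_congr V c (k := k) (k' := k') (l := l₂) fun j hj => hk j (h₂ j hj).ne',
    h.mul_monomial c k' (P := fun m => c m ≠ SlotType.u ∧ m < n) (fun m hm => hm.2.ne')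
      (l := l₁) fun m hm hP => exponent_eq_zero_of_eq_u
        (by_contra fun hc => hP ⟨hc, h₁ m hm⟩) _]
  simp only [mul_assoc]

/-- Slot `n` does not occur in `l₂`, so it is still at its base level; this is what the one-slot
orbit lemmas require. -/
theorem monomial_mem_levelSpace_tail (h : IsTwistedTuple U V) {c : Fin N → SlotType}
    (k : MultiIdx c) {n : Fin N} {l₁ l₂ : List (Fin N)} (hl : List.finRange N = l₁ ++ n :: l₂)
    {x : H} (hx : x ∈ levelSpace V c (baseIdx c)) (t : Bool) (m : ℕ) :
    powProj (dirOp V n t) m (monomial V c k l₂ x) =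
      if (m : ℕ∞) ≤ (c n).level t (c n).base then monomial V c k l₂ x else 0 := by
  have hnd : (l₁ ++ n :: l₂).Nodup := hl ▸ List.nodup_finRange N
  obtain ⟨hn, hnd₂⟩ := List.nodup_cons.1 (List.nodup_append.1 hnd).2.1
  have h1 := (h.monomial_mem_levelSpace k hnd₂ hx).1 (n, t) m
  have h2 : modelLevel c (partialIdx c k l₂) (n, t) = (c n).level t (c n).base := by
    simp [modelLevel, partialIdx, hn]
  rw [h2] at h1
  exact h1

/-- After passing `l₁`, `V n` meets its own power and changes the label from `k n` to `k' n`. The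
central twists are then moved to the right until they act on `x`. -/
theorem apply_monomial_of_source (h : IsTwistedTuple U V) (c : Fin N → SlotType)
    {k k' : MultiIdx c} {n : Fin N} (hn : c n ≠ SlotType.u) (hk : ∀ j, j ≠ n → k j = k' j)
    (hs : (c n).source (k' n) = some (k n)) {x : H} (hx : x ∈ levelSpace V c (baseIdx c)) :
    V n (monomial V c k (List.finRange N) x) = monomial V c k' (List.finRange N)
      (symbolProd U c k' n (fun m => c m ≠ SlotType.u ∧ m < n) (List.finRange N) x) := by
  obtain ⟨l₁, l₂, hl, h₁, h₂⟩ := exists_finRange_eq_append n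
  have e1 := DFunLike.congr_fun (h.apply_monomial_of_ne_u c hk hl h₁ h₂) x
  have e2 := PowerPartial.apply_orbit_of_source (v := dirOp V n) (h.powerPartial n)
    (star_dirOp V n) hn hs (x := monomial V c k' l₂ x)
    fun t m hm => by rw [h.monomial_mem_levelSpace_tail k' hl hx, if_pos hm]
  have e3 := commute_monomial (h.symbolProd_commute_dirOp c k'
    (P := fun m => c m ≠ SlotType.u ∧ m < n) (n := n) (fun m hm => hm.2.ne') (List.finRange N))
    c k' (n :: l₂)
  rw [← mul_apply_eq_comp (V n), e1]
  change monomial V c k' l₁ (symbolProd U c k' n _ (List.finRange N)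
    (dirOp V n true ((dirOp V n (c n).dir ^ (c n).exponent (k n)) (monomial V c k' l₂ x)))) = _
  rw [e2]
  have e4 := DFunLike.congr_fun e3.eq x
  simp only [monomial_cons, mul_apply_eq_comp] at e4
  rw [e4]
  have e5 : monomial V c k' (List.finRange N) = monomial V c k' l₁ * monomial V c k' (n :: l₂) := by
    rw [hl, monomial_append]
  rw [e5]
  rfl

theorem apply_monomial_of_forall_source_ne (h : IsTwistedTuple U V) (c : Fin N → SlotType)
    {k : MultiIdx c} {n : Fin N} (hs : ∀ k', (c n).source k' ≠ some (k n)) {x : H}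
    (hx : x ∈ levelSpace V c (baseIdx c)) : V n (monomial V c k (List.finRange N) x) = 0 := by
  obtain ⟨l₁, l₂, hl, h₁, h₂⟩ := exists_finRange_eq_append n
  have e1 := DFunLike.congr_fun
    (h.apply_monomial_of_ne_u c (k := k) (k' := k) (fun _ _ => rfl) hl h₁ h₂) x
  have e2 := PowerPartial.apply_orbit_of_forall_source_ne (v := dirOp V n) (h.powerPartial n)
    (star_dirOp V n) hs (x := monomial V c k l₂ x)
    fun m hm => by rw [h.monomial_mem_levelSpace_tail k hl hx, if_neg hm.not_ge]
  rw [← mul_apply_eq_comp (V n), e1]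
  change monomial V c k l₁ (symbolProd U c k n _ (List.finRange N)
    (dirOp V n true ((dirOp V n (c n).dir ^ (c n).exponent (k n)) (monomial V c k l₂ x)))) = 0
  rw [e2, map_zero, map_zero]

end IsTwistedTuple

end Monomials

/-! ### Restrictions to a closed subspace -/

section Restriction

variable {H : Type*} [NormedAddCommGroup H] [InnerProductSpace ℂ H] [CompleteSpace H]

/-- `K` reduces `A`, and `A` is unitary on `K`. -/
structure UnitaryOn (A : H →L[ℂ] H) (K : Submodule ℂ H) : Prop where
  mem : ∀ x ∈ K, A x ∈ K
  star_mem : ∀ x ∈ K, star A x ∈ K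
  star_apply : ∀ x ∈ K, star A (A x) = x
  apply_star : ∀ x ∈ K, A (star A x) = x

variable {A : H →L[ℂ] H} {K : Submodule ℂ H} [CompleteSpace K]

/-- The restriction of `A` to a subspace on which it is unitary. -/
def UnitaryOn.restrict (h : UnitaryOn A K) : unitary (K →L[ℂ] K) :=
  ⟨(A.comp K.subtypeL).codRestrict K fun x => h.mem x x.2, by
    have hstar : star ((A.comp K.subtypeL).codRestrict K fun x => h.mem x x.2) =
        ((star A).comp K.subtypeL).codRestrict K fun x => h.star_mem x x.2 := by
      rw [ContinuousLinearMap.star_eq_adjoint, eq_comm, ContinuousLinearMap.eq_adjoint_iff]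
      intro x y
      exact ContinuousLinearMap.adjoint_inner_left A (y : H) (x : H)
    rw [Unitary.mem_iff, hstar]
    constructor
    · ext x
      exact h.star_apply x x.2
    · ext x
      exact h.apply_star x x.2⟩

theorem UnitaryOn.coe_restrict_apply (h : UnitaryOn A K) (x : K) :
    (((h.restrict : K →L[ℂ] K) x : K) : H) = A x := rfl

/-- `star A x` is the preimage of `x` under the restriction, so the inverse of the restriction must
return it. -/
theorem UnitaryOn.coe_star_restrict_apply (h : UnitaryOn A K) (x : K) :
    (((star h.restrict : unitary (K →L[ℂ] K)) : K →L[ℂ] K) x : H) = star A x := by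
  have h1 : (h.restrict : K →L[ℂ] K) ((⟨star A x, h.star_mem x x.2⟩ : K)) = x :=
    Subtype.ext (h.apply_star x x.2)
  have h2 : ((star h.restrict : unitary (K →L[ℂ] K)) : K →L[ℂ] K)
      ((h.restrict : K →L[ℂ] K) ⟨star A x, h.star_mem x x.2⟩) = ⟨star A x, h.star_mem x x.2⟩ :=
    DFunLike.congr_fun (Unitary.coe_star_mul_self h.restrict) _
  rw [h1] at h2
  rw [h2]

omit [CompleteSpace H] in
theorem unitary_ext {T T' : unitary (K →L[ℂ] K)}
    (h : ∀ x : K, ((T : K →L[ℂ] K) x : H) = (T' : K →L[ℂ] K) x) : T = T' :=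
  Subtype.ext (ContinuousLinearMap.ext fun x => Subtype.ext (h x))

end Restriction

/-! ### Operators on the model, evaluated at the vectors `e_k ⊗ η` -/

section Single

variable {ι M : Type*} [NormedAddCommGroup M] [InnerProductSpace ℂ M] [CompleteSpace M]

open Classical in
/-- The vector `e_k ⊗ η`. -/
def elementary (k : ι) (η : M) : lp (fun _ : ι => M) 2 := lp.single 2 k η

omit [InnerProductSpace ℂ M] [CompleteSpace M] in
theorem elementary_apply_self (k : ι) (η : M) : elementary k η k = η := by
  classical exact lp.single_apply_self (E := fun _ => M) 2 k η

omit [InnerProductSpace ℂ M] [CompleteSpace M] in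
theorem elementary_apply_ne {k j : ι} (η : M) (h : j ≠ k) : elementary k η j = 0 := by
  classical exact lp.single_apply_ne (E := fun _ => M) 2 k η h

omit [CompleteSpace M] in
theorem lp_ext_of_elementary {E : Type*} [NormedAddCommGroup E] [NormedSpace ℂ E]
    {f g : lp (fun _ : ι => M) 2 →L[ℂ] E}
    (h : ∀ k (η : M), f (elementary k η) = g (elementary k η)) : f = g := by
  classical exact lp.ext_continuousLinearMap (by norm_num) fun k =>
    ContinuousLinearMap.ext fun η => h k η

theorem weightedOp_elementary (σ : ι → Option ι)
    (hσ : ∀ k k' l, σ k = some l → σ k' = some l → k = k') (A : ι → unitary (M →L[ℂ] M))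
    {k l : ι} (h : σ k = some l) (η : M) :
    weightedOp σ hσ A (elementary l η) = elementary k ((A k : M →L[ℂ] M) η) := by
  ext j
  rw [weightedOp_apply]
  by_cases hj : j = k
  · subst hj
    rw [h, elementary_apply_self]
    exact congrArg _ (elementary_apply_self _ _)
  · rw [elementary_apply_ne _ hj]
    rcases hj' : σ j with _ | l'
    · rfl
    · have : l' ≠ l := fun h' => hj (hσ j k l (h' ▸ hj') h)
      change (A j : M →L[ℂ] M) (elementary l η l') = 0
      rw [elementary_apply_ne _ this, map_zero]

theorem weightedOp_elementary_eq_zero (σ : ι → Option ι)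
    (hσ : ∀ k k' l, σ k = some l → σ k' = some l → k = k') (A : ι → unitary (M →L[ℂ] M))
    {l : ι} (h : ∀ k, σ k ≠ some l) (η : M) :
    weightedOp σ hσ A (elementary l η) = 0 := by
  ext j
  rw [weightedOp_apply]
  rcases hj' : σ j with _ | l'
  · rfl
  · have : l' ≠ l := fun h' => h j (h' ▸ hj')
    change (A j : M →L[ℂ] M) (elementary l η l') = 0
    rw [elementary_apply_ne _ this, map_zero]

variable {N : ℕ} (c : Fin N → SlotType)

theorem lastOp_elementary (T : unitary (M →L[ℂ] M)) (k : MultiIdx c) (η : M) :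
    lastOp c T (elementary k η) = elementary k ((T : M →L[ℂ] M) η) :=
  weightedOp_elementary _ _ _ rfl η

open Classical in
/-- The product of the symbols of the twists of the `n`-th model operator at `e_k`. -/
def twistSymbolProd (W : Fin N → Fin N → unitary (M →L[ℂ] M)) (k : MultiIdx c) (n : Fin N)
    (P : Fin N → Prop) (l : List (Fin N)) : unitary (M →L[ℂ] M) :=
  ((l.filter fun m => P m).map fun m => twistSymbol c W n m ^ (c m).exponent (k m)).prod

theorem twistProd_elementary (W : Fin N → Fin N → unitary (M →L[ℂ] M)) (n : Fin N)
    (P : Fin N → Prop) (k : MultiIdx c) (η : M) :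
    twistProd c W n P (elementary k η) =
      elementary k ((twistSymbolProd c W k n P (List.finRange N) : M →L[ℂ] M) η) := by
  rw [twistProd, twistSymbolProd]
  generalize (List.finRange N).filter _ = l
  induction l with
  | nil => rfl
  | cons a l ih =>
    rw [List.map_cons, List.prod_cons, mul_apply_eq_comp, ih, diagOp,
      weightedOp_elementary _ _ _ rfl]
    rfl

end Single

/-! ### The decomposition -/

namespace IsTwistedTuple

variable {H : Type*} [NormedAddCommGroup H] [InnerProductSpace ℂ H] [CompleteSpace H] {N : ℕ}
  {U : Fin N → Fin N → (H →L[ℂ] H)} {V : Fin N → (H →L[ℂ] H)}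

instance completeSpace_levelSpace (V : Fin N → (H →L[ℂ] H)) (c : Fin N → SlotType)
    (k : MultiIdx c) : CompleteSpace (levelSpace V c k) :=
  (isClosed_levelSpace V c k).completeSpace_coe

theorem unitaryOn_symbol (h : IsTwistedTuple U V) {m n : Fin N} (hmn : m ≠ n)
    (c : Fin N → SlotType) (k : MultiIdx c) : UnitaryOn (U m n) (levelSpace V c k) := by
  have hcomm : ∀ {a b : Fin N}, a ≠ b → ∀ p i, Commute (U a b) (rangeProj V p i) :=
    fun hab p i => by
      have h1 := h.commute_dirOp hab p.1 p.2
      have h2 := h.commute_dirOp hab p.1 (!p.2)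
      rw [← star_dirOp] at h2
      exact (h1.pow_right i).mul_right (h2.pow_right i)
  refine ⟨fun x hx => map_mem_jointLevel (hcomm hmn) hx, fun x hx => ?_, fun x _ => ?_,
    fun x _ => ?_⟩
  · rw [h.star_eq hmn]
    exact map_mem_jointLevel (hcomm hmn.symm) hx
  · exact DFunLike.congr_fun (Unitary.star_mul_self_of_mem (h.mem_unitary hmn)) x
  · exact DFunLike.congr_fun (Unitary.mul_star_self_of_mem (h.mem_unitary hmn)) x

/-- Both levels of a `u` slot are `⊤`, which absorbs a shift by one; so `V n` and its adjoint
preserve the level space and invert each other there. -/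
theorem unitaryOn_of_eq_u (h : IsTwistedTuple U V) {c : Fin N → SlotType} {n : Fin N}
    (hn : c n = SlotType.u) (k : MultiIdx c) : UnitaryOn (V n) (levelSpace V c k) := by
  have htop : ∀ t, modelLevel c k (n, t) = modelLevel c k (n, t) + (1 : ℕ) := by
    have : ∀ (d : SlotType) (i : d.Idx) t, d = SlotType.u → d.level t i = ⊤ := by
      rintro d i t rfl
      rfl
    intro t
    rw [modelLevel, this _ _ _ hn, top_add]
  have key : ∀ t, ∀ x ∈ levelSpace V c k, dirOp V n t x ∈ levelSpace V c k ∧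
      dirOp V n (!t) (dirOp V n t x) = x := fun t x hx => by
    have := h.pow_dirOp_mem_jointLevel (j := n) (t := t) (e := 1) (htop t) (htop (!t))
      (fun _ _ _ => rfl) hx
    rwa [pow_one, pow_one] at this
  exact ⟨fun x hx => (key true x hx).1, fun x hx => (key false x hx).1,
    fun x hx => (key true x hx).2, fun x hx => (key false x hx).2⟩

/-- The last tensor factor: the vectors `e_0 ⊗ η`. -/
abbrev cyclicSpace (V : Fin N → (H →L[ℂ] H)) (c : Fin N → SlotType) : Submodule ℂ H :=
  levelSpace V c (baseIdx c)

/-- The restrictions of the `U m n` to the last tensor factor. -/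
def symbols (h : IsTwistedTuple U V) (c : Fin N → SlotType) (m n : Fin N) :
    unitary (cyclicSpace V c →L[ℂ] cyclicSpace V c) :=
  if hmn : m ≠ n then (h.unitaryOn_symbol hmn c (baseIdx c)).restrict else 1

open Classical in
/-- The restrictions of the `V n` of type `u` to the last tensor factor. -/
def unitaryParts (h : IsTwistedTuple U V) (c : Fin N → SlotType) (n : Fin N) :
    unitary (cyclicSpace V c →L[ℂ] cyclicSpace V c) :=
  if hn : c n = SlotType.u then (h.unitaryOn_of_eq_u hn (baseIdx c)).restrict else 1

theorem symbols_apply (h : IsTwistedTuple U V) (c : Fin N → SlotType) {m n : Fin N} (hmn : m ≠ n)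
    (x : cyclicSpace V c) :
    (((h.symbols c m n : _ →L[ℂ] _) x : cyclicSpace V c) : H) = U m n x := by
  rw [symbols, dif_pos hmn, UnitaryOn.coe_restrict_apply]

theorem star_symbols (h : IsTwistedTuple U V) (c : Fin N → SlotType) {m n : Fin N} (hmn : m ≠ n) :
    h.symbols c n m = star (h.symbols c m n) := by
  refine unitary_ext fun x => ?_
  rw [h.symbols_apply c hmn.symm, symbols, dif_pos hmn, UnitaryOn.coe_star_restrict_apply,
    h.star_eq hmn]

theorem unitaryParts_apply (h : IsTwistedTuple U V) (c : Fin N → SlotType) {n : Fin N}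
    (hn : c n = SlotType.u) (x : cyclicSpace V c) :
    (((h.unitaryParts c n : _ →L[ℂ] _) x : cyclicSpace V c) : H) = V n x := by
  rw [unitaryParts, dif_pos hn, UnitaryOn.coe_restrict_apply]

theorem star_unitaryParts_apply (h : IsTwistedTuple U V) (c : Fin N → SlotType) {n : Fin N}
    (hn : c n = SlotType.u) (x : cyclicSpace V c) :
    ((((star (h.unitaryParts c n) : unitary _) : _ →L[ℂ] _) x : cyclicSpace V c) : H)
      = star (V n) x := by
  rw [unitaryParts, dif_pos hn, UnitaryOn.coe_star_restrict_apply]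

/-- The case split on `b` in `twistSymbol` agrees with `dirSymbol`, because `b` is the only type
generated by the adjoint. -/
theorem twistSymbolProd_apply (h : IsTwistedTuple U V) (c : Fin N → SlotType) (k : MultiIdx c)
    {n : Fin N} {P : Fin N → Prop} (hP : ∀ m, P m → n ≠ m) (l : List (Fin N))
    (x : cyclicSpace V c) :
    (((twistSymbolProd c (h.symbols c) k n P l : _ →L[ℂ] _) x : cyclicSpace V c) : H) =
      symbolProd U c k n P l x := by
  classical
  have hsym : ∀ m, n ≠ m → ∀ (e : ℕ) (y : cyclicSpace V c),
      ((((twistSymbol c (h.symbols c) n m ^ e : unitary _) : _ →L[ℂ] _) y : cyclicSpace V c) : H) =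
        (dirSymbol U n m (c m).dir ^ e) y := by
    intro m hnm e
    have h1 : ∀ y : cyclicSpace V c,
        (((twistSymbol c (h.symbols c) n m : _ →L[ℂ] _) y : cyclicSpace V c) : H) =
          dirSymbol U n m (c m).dir y := fun y => by
      unfold twistSymbol
      split
      next hc =>
        rw [hc]
        exact h.symbols_apply c hnm y
      next hc =>
        have hd : (c m).dir = true := by
          rcases hcm : c m <;> first | rfl | exact absurd hcm hc
        rw [hd]
        exact h.symbols_apply c hnm.symm y
    induction e with
    | zero => intro y; rfl
    | succ e ih =>
      intro y
      rw [pow_succ, pow_succ, mul_apply_eq_comp, ← h1, ← ih]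
      rfl
  induction l with
  | nil => rfl
  | cons a l ih =>
    by_cases ha : P a
    · have e1 : symbolProd U c k n P (a :: l) =
          dirSymbol U n a (c a).dir ^ (c a).exponent (k a) * symbolProd U c k n P l := by
        simp [symbolProd, ha]
      have e2 : twistSymbolProd c (h.symbols c) k n P (a :: l) =
          twistSymbol c (h.symbols c) n a ^ (c a).exponent (k a) *
            twistSymbolProd c (h.symbols c) k n P l := by
        simp [twistSymbolProd, ha]
      rw [e1, e2, mul_apply_eq_comp, ← ih, ← hsym a (hP a ha)]
      rfl
    · have e1 : symbolProd U c k n P (a :: l) = symbolProd U c k n P l := by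
        simp [symbolProd, ha]
      have e2 : twistSymbolProd c (h.symbols c) k n P (a :: l) =
          twistSymbolProd c (h.symbols c) k n P l := by
        simp [twistSymbolProd, ha]
      rw [e1, e2, ih]

/-- The isometry `η ↦ e_k ⊗ η`. -/
def monomialIsometry (h : IsTwistedTuple U V) (c : Fin N → SlotType) (k : MultiIdx c) :
    cyclicSpace V c →ₗᵢ[ℂ] H :=
  ⟨(monomial V c k (List.finRange N)).toLinearMap ∘ₗ (cyclicSpace V c).subtype, fun x =>
    (h.monomial_mem_levelSpace k (List.nodup_finRange N) x.2).2⟩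

theorem monomialIsometry_mem (h : IsTwistedTuple U V) (c : Fin N → SlotType) (k : MultiIdx c)
    (x : cyclicSpace V c) : h.monomialIsometry c k x ∈ levelSpace V c k := by
  have := (h.monomial_mem_levelSpace k (List.nodup_finRange N) x.2).1
  rwa [partialIdx_finRange] at this

theorem orthogonalFamily_monomialIsometry (h : IsTwistedTuple U V) (c : Fin N → SlotType) :
    OrthogonalFamily ℂ (fun _ : MultiIdx c => cyclicSpace V c) (h.monomialIsometry c) :=
  fun k k' hkk' x y => inner_levelSpace_eq_zero (fun he => hkk' (eq_of_heq (Sigma.mk.inj he).2))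
    (h.monomialIsometry_mem c k x) (h.monomialIsometry_mem c k' y)

/-- The isometry from the model of type `c` into `H`. -/
def embed (h : IsTwistedTuple U V) (c : Fin N → SlotType) :
    ModelSpace c (cyclicSpace V c) →ₗᵢ[ℂ] H :=
  (h.orthogonalFamily_monomialIsometry c).linearIsometry

theorem embed_elementary (h : IsTwistedTuple U V) (c : Fin N → SlotType) (k : MultiIdx c)
    (x : cyclicSpace V c) :
    h.embed c (elementary k x) = monomial V c k (List.finRange N) x := by
  rw [embed, elementary, OrthogonalFamily.linearIsometry_apply_single]
  rfl

theorem symbol_embed (h : IsTwistedTuple U V) (c : Fin N → SlotType) {m n : Fin N} (hmn : m ≠ n)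
    (f : ModelSpace c (cyclicSpace V c)) :
    U m n (h.embed c f) = h.embed c (lastOp c (h.symbols c m n) f) := by
  classical
  refine DFunLike.congr_fun (lp_ext_of_elementary
    (f := (U m n).comp (h.embed c).toContinuousLinearMap)
    (g := (h.embed c).toContinuousLinearMap.comp (lastOp c (h.symbols c m n)))
    fun k η => ?_) f
  change U m n (h.embed c _) = h.embed c (lastOp c _ _)
  rw [lastOp_elementary, embed_elementary, embed_elementary, h.symbols_apply c hmn]
  exact DFunLike.congr_fun (commute_monomial (h.commute_dirOp hmn) c k _).eq (η : H)

/-- It suffices to compare on the vectors `e_k ⊗ η`. The cases are: slot `n` of type `u`, a basis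
vector with a successor in slot `n`, and a basis vector that the slot operator kills. -/
theorem apply_embed (h : IsTwistedTuple U V) (c : Fin N → SlotType) (n : Fin N)
    (f : ModelSpace c (cyclicSpace V c)) :
    V n (h.embed c f) = h.embed c (modelOp c (h.symbols c) (h.unitaryParts c) n f) := by
  classical
  refine DFunLike.congr_fun (lp_ext_of_elementary
    (f := (V n).comp (h.embed c).toContinuousLinearMap)
    (g := (h.embed c).toContinuousLinearMap.comp
      (modelOp c (h.symbols c) (h.unitaryParts c) n)) fun k η => ?_) f
  change V n (h.embed c _) = h.embed c (modelOp c _ _ n _)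
  rw [embed_elementary]
  by_cases hn : c n = SlotType.u
  · rw [modelOp, if_pos hn, mul_apply_eq_comp, lastOp_elementary, twistProd_elementary,
      embed_elementary, h.twistSymbolProd_apply c k fun m hm hnm => hm (hnm ▸ hn), h.unitaryParts_apply c hn]
    exact h.apply_monomial_of_eq_u c k hn η
  · rw [modelOp, if_neg hn, mul_apply_eq_comp]
    by_cases hs : ∃ i, (c n).source i = some (k n)
    · obtain ⟨i, hi⟩ := hs
      -- The slot operator sends `e_k` to the basis vector with entry `i` in slot `n`; the twists do
      -- not involve slot `n`.
      have hupd : (fun k : MultiIdx c => ((c n).source (k n)).map (Function.update k n))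
          (Function.update k n i) = some k := by
        simp [hi]
      rw [slotOp, weightedOp_elementary _ _ _ hupd, twistProd_elementary, embed_elementary,
        h.twistSymbolProd_apply c _ fun m hm => hm.2.ne']
      exact h.apply_monomial_of_source c hn
        (fun j hj => (Function.update_of_ne hj _ _).symm) (by simpa using hi) η.2
    · push Not at hs
      rw [h.apply_monomial_of_forall_source_ne c hs η.2, slotOp, weightedOp_elementary_eq_zero,
        map_zero, map_zero]
      intro k' hk'
      rw [Option.map_eq_some_iff] at hk'
      obtain ⟨a, ha, rfl⟩ := hk'
      exact hs (k' n) (by simpa using ha)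

/-- The summand of type `c`. -/
def summand (h : IsTwistedTuple U V) (c : Fin N → SlotType) : Submodule ℂ H :=
  LinearMap.range (h.embed c).toLinearMap

theorem isClosed_summand (h : IsTwistedTuple U V) (c : Fin N → SlotType) :
    IsClosed (h.summand c : Set H) :=
  (h.embed c).isometry.isUniformInducing.isComplete_range.isClosed

theorem inner_embed_eq_zero (h : IsTwistedTuple U V) {c : Fin N → SlotType} {x : H}
    (hx : ∀ k, ∀ y ∈ levelSpace V c k, inner ℂ x y = 0) (f : ModelSpace c (cyclicSpace V c)) :
    inner ℂ x (h.embed c f) = 0 := by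
  refine DFunLike.congr_fun (lp_ext_of_elementary
    (f := (innerSL ℂ x).comp (h.embed c).toContinuousLinearMap) (g := 0) fun k η => ?_) f
  change inner ℂ x (h.embed c _) = 0
  rw [embed_elementary]
  exact hx k _ (h.monomialIsometry_mem c k η)

theorem levelSpace_le_summand (h : IsTwistedTuple U V) (c : Fin N → SlotType) (k : MultiIdx c) :
    levelSpace V c k ≤ h.summand c := by
  classical
  intro y hy
  obtain ⟨x, hx, rfl⟩ := h.exists_monomial_eq k (List.nodup_finRange N)
    (by rwa [partialIdx_finRange])
  exact ⟨elementary k ⟨x, hx⟩, h.embed_elementary c k ⟨x, hx⟩⟩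

theorem inner_summand_eq_zero (h : IsTwistedTuple U V) {c c' : Fin N → SlotType} (hne : c ≠ c')
    {x y : H} (hx : x ∈ h.summand c) (hy : y ∈ h.summand c') : inner ℂ x y = 0 := by
  obtain ⟨f, rfl⟩ := hx
  obtain ⟨g, rfl⟩ := hy
  refine h.inner_embed_eq_zero (fun k' z hz => ?_) g
  rw [inner_eq_zero_symm]
  refine h.inner_embed_eq_zero (fun k w hw => ?_) f
  exact inner_levelSpace_eq_zero (fun he => hne (congrArg Sigma.fst he).symm) hz hw

/-- Every joint level space is some `levelSpace V c k`, hence lies in a summand, so totality of the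
level spaces passes to the summands. -/
theorem eq_zero_of_orthogonal_summand (h : IsTwistedTuple U V) {x : H}
    (hx : ∀ c, ∀ y ∈ h.summand c, inner ℂ x y = 0) : x = 0 := by
  refine eq_zero_of_orthogonal_jointLevel (P := rangeProj V) (star_rangeProj V)
    (fun _ => powProj_zero _) (fun j _ _ hmn => (h.powerPartial j.1 j.2).powProj_mul_of_le hmn)
    (fun i j m n => h.powProj_commute i.1 j.1 i.2 j.2 m n) fun κ y hy => ?_
  obtain ⟨c, k, rfl⟩ := exists_modelLevel_eq κ
  exact hx c y (h.levelSpace_le_summand c k hy)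

theorem isHilbertSum_summand (h : IsTwistedTuple U V) :
    IsHilbertSum ℂ (fun c => h.summand c) (fun c => (h.summand c).subtypeₗᵢ) := by
  have (c : Fin N → SlotType) : CompleteSpace (h.summand c) :=
    (h.isClosed_summand c).completeSpace_coe
  refine IsHilbertSum.mkInternal _
    (fun c c' hne x y => h.inner_summand_eq_zero hne x.2 y.2) ?_
  rw [top_le_iff, Submodule.topologicalClosure_eq_top_iff, Submodule.eq_bot_iff]
  intro x hx
  refine h.eq_zero_of_orthogonal_summand fun c y hy => ?_
  exact Submodule.inner_left_of_mem_orthogonal (le_iSup h.summand c hy) hx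

theorem isReducing_summand (h : IsTwistedTuple U V) (c : Fin N → SlotType) (n : Fin N) :
    IsReducing (V n) (h.summand c) := by
  have hV : ∀ c, ∀ x ∈ h.summand c, V n x ∈ h.summand c := by
    rintro c _ ⟨f, rfl⟩
    exact ⟨_, (h.apply_embed c n f).symm⟩
  intro x hx
  refine ⟨hV c x hx, ?_⟩
  set z := ContinuousLinearMap.adjoint (V n) x
  have : CompleteSpace (h.summand c) := (h.isClosed_summand c).completeSpace_coe
  -- Invariance of all summands under `V n` implies invariance under the adjoint: for `x` in one
  -- summand, `V n* x` is orthogonal to every other summand, hence equals its projection onto its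
  -- own.
  have hz : z - (h.summand c).starProjection z = 0 := by
    refine h.eq_zero_of_orthogonal_summand fun c' y hy => ?_
    by_cases hc : c = c'
    · subst hc
      exact Submodule.inner_left_of_mem_orthogonal hy
        (Submodule.sub_starProjection_mem_orthogonal z)
    · rw [inner_sub_left, h.inner_summand_eq_zero hc (Submodule.starProjection_apply_mem _ z) hy,
        ContinuousLinearMap.adjoint_inner_left, h.inner_summand_eq_zero hc hx (hV c' y hy), sub_zero]
  rw [sub_eq_zero.1 hz]
  exact Submodule.starProjection_apply_mem _ z

end IsTwistedTuple

end TwistedPPI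

end

theorem mainTheorem1 {H : Type v} [NormedAddCommGroup H] [InnerProductSpace ℂ H]
    [CompleteSpace H] {N : ℕ} (U : Fin N → Fin N → (H →L[ℂ] H)) (V : Fin N → (H →L[ℂ] H))
    (hUV : TwistedPPI.IsTwistedTuple U V) :
    ∃ Hs : (Fin N → TwistedPPI.SlotType) → Submodule ℂ H,
      (∀ i, IsClosed (Hs i : Set H)) ∧
      (∀ i n, TwistedPPI.IsReducing (V n) (Hs i)) ∧
      IsHilbertSum ℂ (fun i => Hs i) (fun i => (Hs i).subtypeₗᵢ) ∧
      ∀ i, ∃ (M : Type v) (_ : NormedAddCommGroup M) (_ : InnerProductSpace ℂ M)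
        (_ : CompleteSpace M) (W : Fin N → Fin N → unitary (M →L[ℂ] M))
        (T : Fin N → unitary (M →L[ℂ] M)) (Φ : Hs i ≃ₗᵢ[ℂ] TwistedPPI.ModelSpace i M),
        -- the operators `U m n` restrict to `Hs i`, where they act as `1 ⊗ W m n`
        (∀ m n, m ≠ n → ∀ f : TwistedPPI.ModelSpace i M,
          U m n (Φ.symm f : H) = (Φ.symm (TwistedPPI.lastOp i (W m n) f) : H)) ∧
        -- the `W m n` are commuting unitaries with `W n m = (W m n)*`
        (∀ m n, m ≠ n → W n m = star (W m n)) ∧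
        (∀ m n k l, m ≠ n → k ≠ l → W m n * W k l = W k l * W m n) ∧
        -- the unitaries `T n` are twisted by the `W m n`
        (∀ m n, i m = TwistedPPI.SlotType.u → i n = TwistedPPI.SlotType.u → m ≠ n →
          star (T m) * T n = W m n * T n * star (T m) ∧ T m * T n = W n m * T n * T m) ∧
        (∀ m n k, m ≠ n → i k = TwistedPPI.SlotType.u → T k * W m n = W m n * T k) ∧
        -- one and the same unitary transforms all `V n` into the model operators
        (∀ n, ∀ f : TwistedPPI.ModelSpace i M,
          V n (Φ.symm f : H) = (Φ.symm (TwistedPPI.modelOp i W T n f) : H)) := by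
  refine ⟨hUV.summand, hUV.isClosed_summand, hUV.isReducing_summand, hUV.isHilbertSum_summand,
    fun i => ⟨TwistedPPI.IsTwistedTuple.cyclicSpace V i, inferInstance, inferInstance,
      inferInstance, hUV.symbols i, hUV.unitaryParts i, (hUV.embed i).equivRange.symm,
      fun m n hmn f => hUV.symbol_embed i hmn f, fun m n hmn => hUV.star_symbols i hmn,
      fun m n k l hmn hkl => ?_, fun m n hm hn hmn => ⟨?_, ?_⟩, fun m n k hmn hk => ?_,
      fun n f => hUV.apply_embed i n f⟩⟩
  -- The relations left for `W` and `T` are those of the tuple evaluated at vectors of the cyclic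
  -- space.
  all_goals
    refine TwistedPPI.unitary_ext fun x => ?_
    simp only [Submonoid.coe_mul, mul_apply_eq_comp]
  · rw [hUV.symbols_apply i hmn, hUV.symbols_apply i hkl, hUV.symbols_apply i hkl,
      hUV.symbols_apply i hmn]
    exact DFunLike.congr_fun (hUV.commute_symbols hmn hkl).eq (x : H)
  · rw [hUV.star_unitaryParts_apply i hm, hUV.unitaryParts_apply i hn, hUV.symbols_apply i hmn,
      hUV.unitaryParts_apply i hn, hUV.star_unitaryParts_apply i hm]
    exact DFunLike.congr_fun (hUV.twist_adjoint m n hmn) (x : H)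
  · rw [hUV.unitaryParts_apply i hm, hUV.unitaryParts_apply i hn,
      hUV.symbols_apply i hmn.symm, hUV.unitaryParts_apply i hn, hUV.unitaryParts_apply i hm]
    exact DFunLike.congr_fun (hUV.twist m n hmn) (x : H)
  · rw [hUV.unitaryParts_apply i hk, hUV.symbols_apply i hmn, hUV.symbols_apply i hmn,
      hUV.unitaryParts_apply i hk]
    exact DFunLike.congr_fun (hUV.central m n k hmn) (x : H)
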